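/- **Setting.** Let $b\ge 2$ be an integer, $0\le\theta,\rho<1$ real with $\theta=[0;a_1,a_2,\dots]$ irrational, with convergents $p_k/q_k$ ($p_0=0$, $q_0=1$), and put $q_{-1}=0$, $\theta_k=q_k\theta-p_k$. For $n\ge1$ let $s_n=\lfloor n\theta+\rho\rfloor-\lfloor (n-1)\theta+\rho\rfloor$ (lower word) and $s'_n=\lceil n\theta+\rho\rceil-\lceil (n-1)\theta+\rho\rceil$ (upper word). Let $\xi$ be one of the numbers $\xi_b(\theta,\rho)=(b-1)\sum_{n\ge1}s_n b^{-n}$, $\xi'_b(\theta,\rho)=(b-1)\sum_{n\ge1}s'_n b^{-n}$. **Digits.** Let $(b_k)_{k\ge1}$ be the following sequence of integers. * If $\rho\notin\mathbf Z\theta+\mathbf Z$ or $\rho\in\mathbf Z_{\ge1}\theta+\mathbf Z$: the Ostrowski expansion $\rho-\theta=\sum_{k\ge1}b_k\theta_{k-1}$, i.e. $0\le b_1\le a_1-1$, $0\le b_k\le a_k$, $b_k=0$ whenever $b_{k+1}=a_{k+1}$, and $b_k<a_k$ for infinitely many odd and infinitely many even $k$. * If $\rho-\theta=-m\theta+p$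 with integers $m\ge2$ and $p$: let $q_l<m\le q_{l+1}$ and let $q_{l+1}-m=\delta_1q_0+\cdots+\delta_{l+1}q_l$ be the Ostrowski expansion of this integer ($\delta_1<a_1$, $0\le\delta_k\le a_k$, $\delta_k=0$ if $\delta_{k+1}=a_{k+1}$; leading zeros allowed). Then $(b_k)$ is $\delta_1,\dots,\delta_{l+1},0,a_{l+3},0,a_{l+5},\dots$ for the lower word with $l$ odd and for the upper word with $l$ even, and it is $\delta_1,\dots,\delta_l,\delta_{l+1}+1,a_{l+2}-1,0,a_{l+4},0,a_{l+6},\dots$ for the lower word with $l$ even and for the upper word with $l$ odd. * If $\rho=0$: $(b_k)$ is $0,a_2,0,a_4,\dots$ for the lower word and $a_1-1,0,a_3,0,a_5,\dots$ for the upper word. For $k\ge0$ put $t_k=b_1q_0+\cdots+b_kq_{k-1}$, $r_k=q_k-t_k$ and $$c_k=b^{r_k+q_{k-1}}\,\frac{b^{(a_{k+1}-b_{k+1}-1)q_k}-1}{b^{q_k}-1},\quad d_k=b^{t_k}-1,\quad e_k=b^{r_k}-1,\quad f_k=b^{t_k}\,\frac{b^{b_{k+1}q_k}-1}{b^{q_k}-1}.$$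 **Theorem 2.3.** (1) If $a_k-b_k\ge2$ and $b_k\ge1$ for every $k\ge1$, then the regular continued fraction expansion of $\xi$ is $$\xi=[0;c_0+1,e_0,f_0,c_1,d_1,1,e_1,f_1,c_2,\dots].$$ (2) In general, consider the sequence $c_0,d_0,1,e_0,f_0,c_1,d_1,1,e_1,f_1,c_2,\dots$ and apply the following rules: (i) for every $k$ such that $c_{k+1}<0$, replace the nine terms $c_k,d_k,1,e_k,f_k,c_{k+1},d_{k+1},1,e_{k+1}$ by the single term $c_k+1+e_{k+1}$; (ii) in the new sequence, replace three consecutive terms $x,0,y$ by $x+y$, repeatedly, as long as zeros remain. (Formally, the sequence produced by (i) is cut into consecutive nonempty finite blocks, and each block is turned into one term by finitely many, possibly no, applications of (ii).) There is exactly one sequence $A_1,A_2,\dots$ of positive numbers obtained in this way, it consists of integers, and the regular continued fraction expansion of $\xi$ is $$\xi=[0;A_1,A_2,A_3,\dots].$$ (3) Define words by $M_0=0$, $M_1=0^{a_1-1}1$, $M_k=M_{k-1}^{a_k}M_{k-2}$ for $k\ge2$; let $T_k$ and $R_k$ be the prefix of length $t_k$ and the suffix of length $r_k$ of $M_k$,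 and $V_k=R_kT_k$. Replace the letter $1$ by $b-1$ and read words as integers in base $b$. For $k\ge0$ define the fractions (given by numerator and denominator) $$(1)_k=\frac{R_{k+1}-R_k}{b^{r_{k+1}}-b^{r_k}},\quad (2)_k=\frac{R_{k+1}T_k}{b^{r_{k+1}+t_k}-1},\quad (3)_k=\frac{R_{k+1}M_k-R_{k+1}}{b^{r_{k+1}}(b^{q_k}-1)},\quad (4)_k=\frac{V_{k+1}}{b^{q_{k+1}}-1},$$ and let $(2)_k-(1)_k$ be the fraction obtained by subtracting numerators and denominators separately. Then for every $j\ge1$ there is $k\ge0$ such that the convergent $P_j/Q_j=[0;A_1,\dots,A_j]$ of $\xi$ satisfies one of the following (terms with a negative index do not occur): * $P_j/Q_j=(1)_k$ and $A_j\in\{c_k,\ e_{k-1}+c_k\}$; * $P_j/Q_j=(2)_k-(1)_k$ and $A_j\in\{d_k,\ f_{k-1}+d_k\}$; * $P_j/Q_j=(2)_k$ and $A_j\in\{1,\ e_{k-1}+c_k+1,\ e_{k-1}+1,\ c_k+1\}$; * $P_j/Q_j=(3)_k$ and $A_j\in\{e_k,\ c_{k-1}+e_k+1,\ e_{k-2}+c_{k-1}+e_k+1\}$;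 * $P_j/Q_j=(4)_k$ and $A_j=f_k$. (4) (Böhmer's theorem as a special case.) If $\rho=\theta$, then $$\xi=(b-1)\sum_{j\ge1}b^{-\lfloor j/\theta\rfloor}=\Bigl[0;\ \tfrac{b^{q_1}-b^{q_{-1}}}{b^{q_0}-1},\ \tfrac{b^{q_2}-b^{q_0}}{b^{q_1}-1},\ \tfrac{b^{q_3}-b^{q_1}}{b^{q_2}-1},\ \dots\Bigr].$$ -/

import Mathlib

namespace SturmianCF

/-! ### Regular continued fractions, convergents of the slope -/

/-- `x = [0; u 0, u 1, u 2, …]`: the (infinite) regular continued fraction expansion of `x` has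
integer part `0` and partial quotients `u 0, u 1, …`. -/
def HasRegCF (x : ℝ) (u : ℕ → ℚ) : Prop :=
  (GenContFract.of x).h = 0 ∧
    ∀ n : ℕ, (GenContFract.of x).partDens.get? n = some ((u n : ℚ) : ℝ)

/-- The denominators `q k` of the convergents of `[0; a 1, a 2, …]` (`a 0` is never used). -/
def q (a : ℕ → ℕ) : ℕ → ℕ
  | 0 => 1
  | 1 => a 1
  | k + 2 => a (k + 2) * q a (k + 1) + q a k

/-- The numerators `p k` of the convergents of `[0; a 1, a 2, …]`. -/
def p (a : ℕ → ℕ) : ℕ → ℕ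
  | 0 => 0
  | 1 => 1
  | k + 2 => a (k + 2) * p a (k + 1) + p a k

/-- `qPrev a k = q (k - 1)`, with the convention `q (-1) = 0`. -/
def qPrev (a : ℕ → ℕ) : ℕ → ℕ
  | 0 => 0
  | k + 1 => q a k

/-! ### Sturmian words and Sturmian numbers -/

/-- The two choices of rounding, giving the lower words (floor) and the upper words (ceiling). -/
inductive Rounding
  | lower
  | upper

/-- Floor or ceiling. -/
noncomputable def Rounding.round : Rounding → ℝ → ℤ
  | .lower, x => ⌊x⌋
  | .upper, x => ⌈x⌉

/-- The `n`-th letter (`n ≥ 1`) of the lower, resp. upper, Sturmian word of slope `θ` and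
intercept `ρ`. -/
noncomputable def letter (ε : Rounding) (θ ρ : ℝ) (n : ℕ) : ℤ :=
  ε.round ((n : ℝ) * θ + ρ) - ε.round (((n : ℝ) - 1) * θ + ρ)

/-- The number `(b - 1) * ∑_{n ≥ 1} s_n / b ^ n`. -/
noncomputable def sturmianNumber (b : ℕ) (ε : Rounding) (θ ρ : ℝ) : ℝ :=
  ((b : ℝ) - 1) * ∑' n : ℕ, (letter ε θ ρ (n + 1) : ℝ) / (b : ℝ) ^ (n + 1)

/-! ### Ostrowski digits of the intercept

Digit sequences are indexed from `1`; the value at `0` is never used. -/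

/-- `β` is the Ostrowski expansion of the real number `σ` in base `θ = [0; a 1, a 2, …]`. -/
structure IsOstrowskiExpansion (a : ℕ → ℕ) (θ σ : ℝ) (β : ℕ → ℕ) : Prop where
  first : β 1 < a 1
  le : ∀ k, 1 ≤ k → β k ≤ a k
  rule : ∀ k, 1 ≤ k → β (k + 1) = a (k + 1) → β k = 0
  hasSum : HasSum (fun h : ℕ => (β (h + 1) : ℝ) * ((q a h : ℝ) * θ - (p a h : ℝ))) σ
  odd_lt : {k : ℕ | Odd k ∧ β k < a k}.Infinite
  even_lt : {k : ℕ | 1 ≤ k ∧ Even k ∧ β k < a k}.Infinite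

/-- `δ 1, …, δ (l + 1)` are the Ostrowski digits of the integer `N`, that is,
`N = δ 1 * q 0 + ⋯ + δ (l + 1) * q l` (leading zeros are allowed). -/
structure IsIntOstrowski (a : ℕ → ℕ) (l N : ℕ) (δ : ℕ → ℕ) : Prop where
  first : δ 1 < a 1
  le : ∀ k, 1 ≤ k → k ≤ l + 1 → δ k ≤ a k
  rule : ∀ k, 1 ≤ k → k ≤ l → δ (k + 1) = a (k + 1) → δ k = 0
  sum : N = ∑ j ∈ Finset.range (l + 1), δ (j + 1) * q a j

/-- The sequence `δ 1, …, δ (l+1), 0, a (l+3), 0, a (l+5), …`. -/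
def tailA (a δ : ℕ → ℕ) (l k : ℕ) : ℕ :=
  if k ≤ l + 1 then δ k else if Odd (k - l) then a k else 0

/-- The sequence `δ 1, …, δ l, δ (l+1) + 1, a (l+2) - 1, 0, a (l+4), 0, a (l+6), …`. -/
def tailB (a δ : ℕ → ℕ) (l k : ℕ) : ℕ :=
  if k ≤ l then δ k
  else if k = l + 1 then δ k + 1
  else if k = l + 2 then a k - 1
  else if Even (k - l) then a k else 0

/-- For an intercept with `ρ - θ = -m θ + (integer)`, `m ≥ 1`: which of the two sequences above
is attached to the lower word and which to the upper word. It depends on the parity of `l`. -/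
def specialDigits (a δ : ℕ → ℕ) (l : ℕ) : Rounding → ℕ → ℕ
  | .lower => if Odd l then tailA a δ l else tailB a δ l
  | .upper => if Odd l then tailB a δ l else tailA a δ l

/-- The two sequences in the case `ρ = 0`: the lower word has the digits `0, a 2, 0, a 4, …` of
`-θ`, the upper word the digits `a 1 - 1, 0, a 3, 0, a 5, …` of `1 - θ`. -/
def zeroDigits (a : ℕ → ℕ) : Rounding → ℕ → ℕ
  | .lower, k => if Even k then a k else 0
  | .upper, k => if k = 1 then a 1 - 1 else if Odd k then a k else 0

/-- `β` is the sequence of digits attached to the Sturmian word of slope `θ = [0; a 1, a 2, …]`,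
intercept `ρ` and type `ε` (lower or upper). -/
def IsInterceptDigits (ε : Rounding) (a : ℕ → ℕ) (θ ρ : ℝ) (β : ℕ → ℕ) : Prop :=
  (((¬ ∃ m n : ℤ, ρ = m * θ + n) ∨ (∃ m n : ℤ, 1 ≤ m ∧ ρ = m * θ + n)) ∧
      IsOstrowskiExpansion a θ (ρ - θ) β) ∨
  (∃ (m : ℕ) (n : ℤ) (l : ℕ) (δ : ℕ → ℕ), 2 ≤ m ∧ ρ - θ = -(m : ℝ) * θ + n ∧
      q a l < m ∧ m ≤ q a (l + 1) ∧ IsIntOstrowski a l (q a (l + 1) - m) δ ∧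
      ∀ k, 1 ≤ k → β k = specialDigits a δ l ε k) ∨
  (ρ = 0 ∧ ∀ k, 1 ≤ k → β k = zeroDigits a ε k)

/-! ### The improper continued fraction -/

/-- `t k = β 1 * q 0 + ⋯ + β k * q (k - 1)`. -/
def t (a β : ℕ → ℕ) (k : ℕ) : ℕ := ∑ j ∈ Finset.range k, β (j + 1) * q a j

/-- `r k = q k - t k`. -/
def r (a β : ℕ → ℕ) (k : ℕ) : ℤ := (q a k : ℤ) - (t a β k : ℤ)

def cSeq (b : ℕ) (a β : ℕ → ℕ) (k : ℕ) : ℚ :=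
  (b : ℚ) ^ (r a β k + (qPrev a k : ℤ)) *
    (((b : ℚ) ^ (((a (k + 1) : ℤ) - (β (k + 1) : ℤ) - 1) * (q a k : ℤ)) - 1) /
      ((b : ℚ) ^ q a k - 1))

def dSeq (b : ℕ) (a β : ℕ → ℕ) (k : ℕ) : ℚ := (b : ℚ) ^ t a β k - 1

def eSeq (b : ℕ) (a β : ℕ → ℕ) (k : ℕ) : ℚ := (b : ℚ) ^ r a β k - 1

def fSeq (b : ℕ) (a β : ℕ → ℕ) (k : ℕ) : ℚ :=
  (b : ℚ) ^ t a β k * (((b : ℚ) ^ (β (k + 1) * q a k) - 1) / ((b : ℚ) ^ q a k - 1))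

/-- The sequence `c 0, d 0, 1, e 0, f 0, c 1, d 1, 1, e 1, f 1, c 2, …`, indexed from `0`. -/
def improper (b : ℕ) (a β : ℕ → ℕ) (i : ℕ) : ℚ :=
  match i % 5 with
  | 0 => cSeq b a β (i / 5)
  | 1 => dSeq b a β (i / 5)
  | 2 => 1
  | 3 => eSeq b a β (i / 5)
  | _ => fSeq b a β (i / 5)

/-- The expansion `c 0 + 1, e 0, f 0, c 1, d 1, 1, e 1, f 1, c 2, …`. -/
def genericExpansion (b : ℕ) (a β : ℕ → ℕ) : ℕ → ℚ
  | 0 => cSeq b a β 0 + 1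
  | n + 1 => improper b a β (n + 3)

/-- A nine-term block `c k, d k, 1, e k, f k, c (k+1), d (k+1), 1, e (k+1)` with `c (k+1) < 0`
starts at position `i` of the improper expansion. -/
def MergeAt (b : ℕ) (a β : ℕ → ℕ) (i : ℕ) : Prop :=
  i % 5 = 0 ∧ cSeq b a β (i / 5 + 1) < 0

instance (b : ℕ) (a β : ℕ → ℕ) (i : ℕ) : Decidable (MergeAt b a β i) :=
  inferInstanceAs (Decidable (_ ∧ _))

/-- Position in the improper expansion at which the `n`-th term after rule (i) starts. -/
def mergePos (b : ℕ) (a β : ℕ → ℕ) : ℕ → ℕ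
  | 0 => 0
  | n + 1 =>
    if MergeAt b a β (mergePos b a β n) then mergePos b a β n + 9 else mergePos b a β n + 1

/-- Rule (i): the improper expansion in which every nine-term block as above is replaced by the
single term `c k + 1 + e (k+1)`, all other terms being kept. -/
def merged (b : ℕ) (a β : ℕ → ℕ) (n : ℕ) : ℚ :=
  if MergeAt b a β (mergePos b a β n) then
    cSeq b a β (mergePos b a β n / 5) + 1 + eSeq b a β (mergePos b a β n / 5 + 1)
  else improper b a β (mergePos b a β n)

/-- Rule (ii), one application: three consecutive terms `x, 0, y` are replaced by `x + y`. -/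
inductive ZeroStep : List ℚ → List ℚ → Prop
  | mk (l m : List ℚ) (x y : ℚ) : ZeroStep (l ++ x :: 0 :: y :: m) (l ++ (x + y) :: m)

/-- The infinite sequence `A` is obtained from the infinite sequence `u` by applications of
rule (ii): `u` is cut into consecutive nonempty finite blocks, and the `n`-th block is
transformed into the single term `A n` by finitely many (possibly no) applications of rule (ii). -/
def IsContraction (u A : ℕ → ℚ) : Prop :=
  ∃ s : ℕ → ℕ, s 0 = 0 ∧ StrictMono s ∧
    ∀ n, Relation.ReflTransGen ZeroStep
      ((List.range' (s n) (s (n + 1) - s n)).map u) [A n]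

/-! ### The five types of convergents -/

/-- The words `M k`, of length `q k` for `k ≥ 0`. -/
def M (a : ℕ → ℕ) : ℕ → List ℕ
  | 0 => [0]
  | 1 => List.replicate (a 1 - 1) 0 ++ [1]
  | k + 2 => (List.replicate (a (k + 2)) (M a (k + 1))).flatten ++ M a k

/-- `T k`, the prefix of length `t k` of `M k`. -/
def T (a β : ℕ → ℕ) (k : ℕ) : List ℕ := (M a k).take (t a β k)

/-- `R k`, the suffix of length `r k = q k - t k` of `M k`. -/
def R (a β : ℕ → ℕ) (k : ℕ) : List ℕ := (M a k).drop (t a β k)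

/-- The integer whose base-`b` expansion, leading digit first, is the word `w` with the letter `1`
replaced by `b - 1`. -/
def val (b : ℕ) (w : List ℕ) : ℚ := (Nat.ofDigits b (w.reverse.map (fun x => (b - 1) * x)) : ℕ)

/-- The fraction `(1)_k = (R_{k+1} - R_k) / (b^{r_{k+1}} - b^{r_k})`. -/
def conv1 (b : ℕ) (a β : ℕ → ℕ) (k : ℕ) : ℚ :=
  (val b (R a β (k + 1)) - val b (R a β k)) / ((b : ℚ) ^ r a β (k + 1) - (b : ℚ) ^ r a β k)

/-- The fraction `(2)_k = R_{k+1} T_k / (b^{r_{k+1} + t_k} - 1)`. -/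
def conv2 (b : ℕ) (a β : ℕ → ℕ) (k : ℕ) : ℚ :=
  val b (R a β (k + 1) ++ T a β k) / ((b : ℚ) ^ (r a β (k + 1) + (t a β k : ℤ)) - 1)

/-- The fraction `(2)_k - (1)_k`: numerators and denominators are subtracted separately. -/
def conv21 (b : ℕ) (a β : ℕ → ℕ) (k : ℕ) : ℚ :=
  (val b (R a β (k + 1) ++ T a β k) - (val b (R a β (k + 1)) - val b (R a β k))) /
    ((b : ℚ) ^ (r a β (k + 1) + (t a β k : ℤ)) - 1 -
      ((b : ℚ) ^ r a β (k + 1) - (b : ℚ) ^ r a β k))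

/-- The fraction `(3)_k = (R_{k+1} M_k - R_{k+1}) / (b^{r_{k+1}} (b^{q_k} - 1))`. -/
def conv3 (b : ℕ) (a β : ℕ → ℕ) (k : ℕ) : ℚ :=
  (val b (R a β (k + 1) ++ M a k) - val b (R a β (k + 1))) /
    ((b : ℚ) ^ r a β (k + 1) * ((b : ℚ) ^ q a k - 1))

/-- The fraction `(4)_k = V_{k+1} / (b^{q_{k+1}} - 1)`, where `V_{k+1} = R_{k+1} T_{k+1}`. -/
def conv4 (b : ℕ) (a β : ℕ → ℕ) (k : ℕ) : ℚ :=
  val b (R a β (k + 1) ++ T a β (k + 1)) / ((b : ℚ) ^ q a (k + 1) - 1)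

/-- The possible pairs of a partial quotient `x` and the corresponding convergent `v` (the value
of the continued fraction cut just after `x`). -/
def IsTypedConvergent (b : ℕ) (a β : ℕ → ℕ) (x v : ℚ) : Prop :=
  ∃ k : ℕ,
    ((x = cSeq b a β k ∨ (1 ≤ k ∧ x = eSeq b a β (k - 1) + cSeq b a β k)) ∧
      v = conv1 b a β k) ∨
    ((x = dSeq b a β k ∨ (1 ≤ k ∧ x = fSeq b a β (k - 1) + dSeq b a β k)) ∧
      v = conv21 b a β k) ∨
    ((x = 1 ∨ (1 ≤ k ∧ x = eSeq b a β (k - 1) + cSeq b a β k + 1) ∨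
        (1 ≤ k ∧ x = eSeq b a β (k - 1) + 1) ∨ x = cSeq b a β k + 1) ∧
      v = conv2 b a β k) ∨
    ((x = eSeq b a β k ∨ (1 ≤ k ∧ x = cSeq b a β (k - 1) + eSeq b a β k + 1) ∨
        (2 ≤ k ∧ x = eSeq b a β (k - 2) + cSeq b a β (k - 1) + eSeq b a β k + 1)) ∧
      v = conv3 b a β k) ∨
    (x = fSeq b a β k ∧ v = conv4 b a β k)

/-- The partial quotients `(b^{q_{n+1}} - b^{q_{n-1}}) / (b^{q_n} - 1)`, `n ≥ 0`, of the
characteristic Sturmian numbers. -/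
def bohmerQuotient (b : ℕ) (a : ℕ → ℕ) (n : ℕ) : ℚ :=
  ((b : ℚ) ^ q a (n + 1) - (b : ℚ) ^ qPrev a n) / ((b : ℚ) ^ q a n - 1)

end SturmianCF

/-!
Why the theorem holds. Write `[0; x_0, x_1, …]` as a product of the matrices `!![x, 1; 1, 0]`; the
first column of such a product holds the denominator and the numerator of a convergent. Multiplied
by `b - 1`, the prefix products of the improper expansion `c_0, d_0, 1, e_0, f_0, c_1, …` have as
columns the denominators and numerators of the five types of fractions
(`AdmissibleDigits.prefixMat_improper_succ`). This is a recursion between values of words, and rests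
on `T_{k+1} = M_k^{β_{k+1}} T_k` and `T_{k+1} R_{k+2} = M_{k+1}^{a_{k+2} - β_{k+2}} M_k`.

Both rewriting rules preserve products of matrices: rule (ii) because
`!![x, 1; 1, 0] * !![0, 1; 1, 0] * !![y, 1; 1, 0] = !![x + y, 1; 1, 0]`, rule (i) because a
negative `c_{k+1}` equals `-(e_k + 1)`, with `f_k = 0` and `d_{k+1} = d_k`
(`AdmissibleDigits.listMat_merge`). So the convergents of a contraction of the merged expansion are
convergents of the improper one, hence of the five types. After rule (i) all terms are nonnegative
integers, and a late convergent of such an expansion is a mediant of neighbouring convergents of any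
positive contraction `A`. Consequently every limit point `x` of these convergents lies on the
correct side of all convergents of `A`, which makes `A` the regular continued fraction expansion of
`x` (`hasRegCF_of_isContraction`). This also gives the uniqueness of `A`, and it reduces the generic
expansion and the expansion of Böhmer's theorem to exhibiting one positive contraction each.
The existence of a positive contraction is a finite case analysis of the zeros among `f_k`,
`c_{k+1}` and `d_{k+1}` (`AdmissibleDigits.exists_block`), since `1` and `e_k` are always positive.

It remains to see that `ξ` is a limit point. The fraction `V_k / (b^{q_k} - 1)` is the number whose
expansion is periodic with period `V_k`. The word `M_k` is the Sturmian word of the rational slope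
`p_k / q_k`: its letters are differences of `⌊z p_k / q_k⌋` for even `k`, and of
`⌈z p_k / q_k⌉ - 1` for odd `k` (`M_eq_map`). So the letters of the periodic words are differences
of roundings of numbers that converge to `n θ + ρ`, and they converge to those of the Sturmian word as
long as `n θ + ρ` is not an integer. If `ρ - θ = -m θ + N` with `m ≥ 1`, one integer occurs; then
`t_k = q_k - m` for all large `k` of one parity, and the digits of the lower and the upper word are
made such that this parity is the one that rounds correctly (`IsInterceptDigits.spec`).
-/

namespace SturmianCF
open Filter Topology

/-! ### Continued fractions as products of matrices -/

/-- The matrix of one continued fraction step: a continued fraction with terms `x_0, x_1, …` has its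
denominators and numerators in the products of the matrices `stepMat (x_i)`. -/
def stepMat (x : ℚ) : Matrix (Fin 2) (Fin 2) ℚ := !![x, 1; 1, 0]

/-- The product of the matrices of the terms of a finite expansion. -/
def listMat (l : List ℚ) : Matrix (Fin 2) (Fin 2) ℚ := (l.map stepMat).prod

/-- The product of the first `n` matrices of the expansion `u`. Its rows are
`den u n, den u (n - 1)` and `num u n, num u (n - 1)`. -/
def prefixMat (u : ℕ → ℚ) (n : ℕ) : Matrix (Fin 2) (Fin 2) ℚ := listMat ((List.range n).map u)

theorem listMat_nil : listMat [] = 1 := rfl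

theorem listMat_cons (x : ℚ) (l : List ℚ) : listMat (x :: l) = stepMat x * listMat l := by
  simp [listMat]

theorem listMat_append (l m : List ℚ) : listMat (l ++ m) = listMat l * listMat m := by
  simp [listMat]

theorem prefixMat_zero (u : ℕ → ℚ) : prefixMat u 0 = 1 := rfl

theorem prefixMat_succ (u : ℕ → ℚ) (n : ℕ) :
    prefixMat u (n + 1) = prefixMat u n * stepMat (u n) := by
  simp [prefixMat, List.range_succ, listMat]

theorem prefixMat_add (u : ℕ → ℚ) (m n : ℕ) :
    prefixMat u (m + n) = prefixMat u m * listMat ((List.range' m n).map u) := by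
  rw [prefixMat, prefixMat, ← listMat_append, ← List.map_append, List.range_eq_range',
    List.range_eq_range', List.range'_append_1 |>.symm]
  simp

/-- The denominator of `[0; u 0, …, u (n - 1)]`, not reduced. -/
def den (u : ℕ → ℚ) (n : ℕ) : ℚ := prefixMat u n 0 0

/-- The numerator of `[0; u 0, …, u (n - 1)]`, not reduced. -/
def num (u : ℕ → ℚ) (n : ℕ) : ℚ := prefixMat u n 1 0

theorem prefixMat_succ_apply_zero (u : ℕ → ℚ) (n : ℕ) (i : Fin 2) :
    prefixMat u (n + 1) i 0 = prefixMat u n i 0 * u n + prefixMat u n i 1 := by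
  rw [prefixMat_succ]
  simp [Matrix.mul_apply, Fin.sum_univ_two, stepMat]

theorem prefixMat_succ_apply_one (u : ℕ → ℚ) (n : ℕ) (i : Fin 2) :
    prefixMat u (n + 1) i 1 = prefixMat u n i 0 := by
  rw [prefixMat_succ]
  simp [Matrix.mul_apply, Fin.sum_univ_two, stepMat]

theorem den_zero (u : ℕ → ℚ) : den u 0 = 1 := by simp [den, prefixMat_zero]
theorem num_zero (u : ℕ → ℚ) : num u 0 = 0 := by simp [num, prefixMat_zero]
theorem den_one (u : ℕ → ℚ) : den u 1 = u 0 := by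
  simp [den, prefixMat_succ_apply_zero, prefixMat_zero]
theorem num_one (u : ℕ → ℚ) : num u 1 = 1 := by
  simp [num, prefixMat_succ_apply_zero, prefixMat_zero]
theorem den_add_two (u : ℕ → ℚ) (n : ℕ) :
    den u (n + 2) = u (n + 1) * den u (n + 1) + den u n := by
  rw [den, prefixMat_succ_apply_zero, prefixMat_succ_apply_one, den, den, mul_comm]
theorem num_add_two (u : ℕ → ℚ) (n : ℕ) :
    num u (n + 2) = u (n + 1) * num u (n + 1) + num u n := by
  rw [num, prefixMat_succ_apply_zero, prefixMat_succ_apply_one, num, num, mul_comm]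

theorem den_mul_num_sub (u : ℕ → ℚ) (n : ℕ) :
    den u n * num u (n + 1) - num u n * den u (n + 1) = (-1) ^ n := by
  induction n with
  | zero => simp [den_zero, num_zero, num_one]
  | succ n ih => rw [den_add_two, num_add_two, pow_succ, ← ih]; ring

theorem HasRegCF.get {x : ℝ} {u : ℕ → ℚ} (h : HasRegCF x u) (n : ℕ) :
    (GenContFract.of x).s.get? n = some ⟨1, (u n : ℝ)⟩ := by
  obtain ⟨gp, hgp, hb⟩ := GenContFract.exists_s_b_of_partDen (h.2 n)
  have := (GenContFract.of_partNum_eq_one_and_exists_int_partDen_eq hgp).1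
  rw [hgp]
  cases gp
  simp_all

/-- The numerators and denominators computed by Mathlib are the entries of the matrix products. -/
theorem HasRegCF.nums_dens {x : ℝ} {u : ℕ → ℚ} (h : HasRegCF x u) (n : ℕ) :
    (GenContFract.of x).nums n = (num u n : ℝ) ∧ (GenContFract.of x).dens n = (den u n : ℝ) := by
  induction n using Nat.twoStepInduction with
  | zero =>
    rw [GenContFract.zeroth_num_eq_h, GenContFract.zeroth_den_eq_one, h.1, num_zero, den_zero]
    simp
  | one =>
    have h0 := h.get 0
    rw [GenContFract.first_num_eq h0, GenContFract.first_den_eq h0, h.1, num_one, den_one]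
    simp
  | more n ih1 ih2 =>
    rw [GenContFract.nums_recurrence (h.get (n + 1)) ih1.1 ih2.1,
      GenContFract.dens_recurrence (h.get (n + 1)) ih1.2 ih2.2, num_add_two, den_add_two]
    push_cast
    simp

theorem HasRegCF.convs {x : ℝ} {u : ℕ → ℚ} (h : HasRegCF x u) (n : ℕ) :
    (GenContFract.of x).convs n = ((num u n / den u n : ℚ) : ℝ) := by
  rw [GenContFract.conv_eq_num_div_den, (h.nums_dens n).1, (h.nums_dens n).2]
  push_cast; rfl

theorem HasRegCF.unique {x : ℝ} {u v : ℕ → ℚ} (hu : HasRegCF x u) (hv : HasRegCF x v) : u = v := by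
  funext n
  have h := (hu.2 n).symm.trans (hv.2 n)
  exact_mod_cast Option.some.inj h

theorem HasRegCF.one_le {x : ℝ} {u : ℕ → ℚ} (h : HasRegCF x u) (n : ℕ) : 1 ≤ u n := by
  exact_mod_cast GenContFract.of_one_le_get?_partDen (h.2 n)

theorem den_pos {u : ℕ → ℚ} (hu : ∀ n, 1 ≤ u n) (n : ℕ) : 0 < den u n := by
  induction n using Nat.twoStepInduction with
  | zero => simp [den_zero]
  | one => rw [den_one]; linarith [hu 0]
  | more n ih1 ih2 =>
    rw [den_add_two]
    have := hu (n + 1)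
    positivity

/-- A number on the correct side of all the convergents `[0; A 0, …, A (n - 1)]` has the regular
continued fraction expansion `[0; A 0, A 1, …]`. -/
theorem hasRegCF_of_sign {A : ℕ → ℕ} (hA : ∀ n, 0 < A n) {x : ℝ}
    (hx : ∀ n, 0 ≤ (-1 : ℝ) ^ n * ((den (fun i => (A i : ℚ)) n : ℝ) * x -
      (num (fun i => (A i : ℚ)) n : ℝ))) :
    HasRegCF x (fun i => (A i : ℚ)) := by
  set u : ℕ → ℚ := fun i => (A i : ℚ) with hu
  set D : ℕ → ℝ := fun n => (-1 : ℝ) ^ n * ((den u n : ℝ) * x - (num u n : ℝ)) with hD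
  have hD0 : D 0 = x := by simp [hD, den_zero, num_zero]
  have hD1 : D 1 = 1 - A 0 * x := by simp [hD, den_one, num_one, hu]
  have hrec : ∀ n, D (n + 2) = D n - A (n + 1) * D (n + 1) := by
    intro n
    simp only [hD, den_add_two, num_add_two, hu]
    push_cast
    ring
  -- `D n = 0` would force `D (n + 1) = 0`, so that two neighbouring convergents would coincide
  have hpos : ∀ n, 0 < D n := by
    intro n
    refine lt_of_le_of_ne (hx n) fun h0 => ?_
    have h1 : D (n + 1) = 0 := by
      have h2 : 0 ≤ D (n + 2) := hx (n + 2)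
      rw [hrec, ← show (0 : ℝ) = D n from h0] at h2
      have h3 : 0 ≤ D (n + 1) := hx (n + 1)
      have h4 : (0 : ℝ) < A (n + 1) := by exact_mod_cast hA (n + 1)
      nlinarith
    have h0' : D n = 0 := h0.symm
    simp only [hD, mul_eq_zero, pow_eq_zero_iff', neg_eq_zero, one_ne_zero, false_and,
      false_or] at h0' h1
    have hdet : (den u n : ℝ) * num u (n + 1) - num u n * den u (n + 1) = (-1) ^ n := by
      exact_mod_cast den_mul_num_sub u n
    have : (den u n : ℝ) * num u (n + 1) - num u n * den u (n + 1) = 0 := by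
      linear_combination (den u (n + 1) : ℝ) * h0' - (den u n : ℝ) * h1
    rw [this] at hdet
    exact absurd hdet.symm (by simp)
  -- the remainders, starting with the convention `E 0 = 1`
  let E : ℕ → ℝ := fun n => Nat.casesOn n 1 D
  have hE : ∀ n, 0 < E n := by
    rintro (_ | n)
    · exact one_pos
    · exact hpos n
  have hErec : ∀ n, E n = A n * E (n + 1) + E (n + 2) := by
    rintro (_ | n)
    · change (1 : ℝ) = A 0 * D 0 + D 1
      rw [hD0, hD1]; ring
    · change D n = A (n + 1) * D (n + 1) + D (n + 2)
      rw [hrec]; ring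
  have hlt : ∀ n, E (n + 1) < E n := by
    intro n
    have h1 : (1 : ℝ) ≤ A n := by exact_mod_cast hA n
    have := hErec n
    nlinarith [hE (n + 1), hE (n + 2)]
  have hdiv : ∀ n, 0 < E (n + 1) / E n := fun n => div_pos (hE (n + 1)) (hE n)
  have hof : ∀ n (z : ℤ) (y : ℝ), y = z + E (n + 1) / E n →
      GenContFract.IntFractPair.of y = ⟨z, E (n + 1) / E n⟩ := by
    intro n z y hy
    have h0 : 0 ≤ E (n + 1) / E n := (hdiv n).le
    have h1 : E (n + 1) / E n < 1 := (div_lt_one (hE _)).2 (hlt n)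
    have hfl : ⌊y⌋ = z := by
      rw [Int.floor_eq_iff]; constructor <;> linarith
    rw [GenContFract.IntFractPair.of, Int.fract, hfl, hy]
    simp
  have hx0 : GenContFract.IntFractPair.of x = ⟨0, E 1 / E 0⟩ := by
    refine hof 0 0 x ?_
    change x = _ + D 0 / 1
    rw [hD0]; simp
  have hstream : ∀ n, GenContFract.IntFractPair.stream x (n + 1) =
      some ⟨A n, E (n + 2) / E (n + 1)⟩ := by
    have key : ∀ n, GenContFract.IntFractPair.of (E (n + 1) / E n)⁻¹ =
        ⟨A n, E (n + 2) / E (n + 1)⟩ := by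
      intro n
      refine hof (n + 1) (A n) _ ?_
      have := (hE (n + 1)).ne'
      rw [inv_div, hErec n]
      push_cast
      field_simp
    intro n
    induction n with
    | zero =>
      have h := GenContFract.IntFractPair.stream_succ_of_some
        (GenContFract.IntFractPair.stream_zero x)
        (by rw [hx0]; exact (hdiv 0).ne')
      rw [h, hx0]
      exact congrArg some (key 0)
    | succ n ih =>
      rw [GenContFract.IntFractPair.stream_succ_of_some ih (hdiv (n + 1)).ne']
      exact congrArg some (key (n + 1))
  constructor
  · rw [GenContFract.of_h_eq_intFractPair_seq1_fst_b, GenContFract.IntFractPair.seq1_fst_eq_of, hx0]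
    simp
  · intro n
    rw [GenContFract.partDen_eq_s_b
      (GenContFract.get?_of_eq_some_of_succ_get?_intFractPair_stream (hstream n))]
    simp [hu]

/-! ### Contractions -/

theorem stepMat_zero_merge (x y : ℚ) : stepMat x * (stepMat 0 * stepMat y) = stepMat (x + y) := by
  ext i j
  fin_cases i <;> fin_cases j <;>
    simp [stepMat, Matrix.mul_apply, Fin.sum_univ_two]

theorem ZeroStep.listMat_eq {l m : List ℚ} (h : ZeroStep l m) : listMat l = listMat m := by
  cases h with
  | mk l m x y =>
    simp only [listMat_append, listMat_cons, ← stepMat_zero_merge, mul_assoc]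

theorem ZeroStep.sum_eq {l m : List ℚ} (h : ZeroStep l m) : l.sum = m.sum := by
  cases h with
  | mk l m x y => simp; ring

theorem reflTransGen_listMat {l m : List ℚ} (h : Relation.ReflTransGen ZeroStep l m) :
    listMat l = listMat m := by
  induction h with
  | refl => rfl
  | tail _ h ih => exact ih.trans h.listMat_eq

theorem reflTransGen_sum {l m : List ℚ} (h : Relation.ReflTransGen ZeroStep l m) :
    l.sum = m.sum := by
  induction h with
  | refl => rfl
  | tail _ h ih => exact ih.trans h.sum_eq

theorem prefixMat_contraction {u A : ℕ → ℚ} {s : ℕ → ℕ} (h0 : s 0 = 0) (hs : StrictMono s)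
    (h : ∀ n, Relation.ReflTransGen ZeroStep
      ((List.range' (s n) (s (n + 1) - s n)).map u) [A n]) (n : ℕ) :
    prefixMat A n = prefixMat u (s n) := by
  induction n with
  | zero => rw [h0]; rfl
  | succ n ih =>
    have hle : s n ≤ s (n + 1) := (hs (Nat.lt_succ_self n)).le
    have := prefixMat_add u (s n) (s (n + 1) - s n)
    rw [Nat.add_sub_cancel' hle, reflTransGen_listMat (h n), ← ih] at this
    rw [this, prefixMat_succ]
    simp [listMat]

theorem listMat_nonneg {l : List ℚ} (hl : ∀ x ∈ l, 0 ≤ x) (i j : Fin 2) : 0 ≤ listMat l i j := by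
  induction l generalizing i with
  | nil => simp only [listMat_nil, Matrix.one_apply]; split_ifs <;> norm_num
  | cons x l ih =>
    have hx := hl x (by simp)
    have ih' := fun i => ih (fun y hy => hl y (by simp [hy])) i
    rw [listMat_cons, Matrix.mul_apply, Fin.sum_univ_two]
    fin_cases i <;> simp [stepMat] <;> nlinarith [ih' 0, ih' 1, mul_nonneg hx (ih' 0)]

/-- If a positive sequence `A` is a contraction of a sequence `u` of nonnegative integers, and `x` is
a limit point of the convergents of `u`, then `A` is the regular continued fraction of `x`: every late
convergent of `u` is a mediant of two neighbouring convergents of `A`. -/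
theorem hasRegCF_of_isContraction {u A : ℕ → ℚ} (hu : ∀ n, ∃ z : ℕ, u n = z)
    (hA : ∀ n, 0 < A n) (hc : IsContraction u A) {x : ℝ}
    (hx : ∀ N, ∀ η : ℝ, 0 < η → ∃ j, N ≤ j ∧ 0 < den u j ∧
      |((num u j / den u j : ℚ) : ℝ) - x| < η) :
    HasRegCF x A ∧ ∀ n, ∃ z : ℕ, A n = z := by
  obtain ⟨s, h0, hs, hblock⟩ := hc
  have hlistnat : ∀ l : List ℕ, ∃ z : ℕ, (l.map u).sum = z := by
    intro l
    induction l with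
    | nil => exact ⟨0, by simp⟩
    | cons i l ih =>
      obtain ⟨y, hy⟩ := ih
      obtain ⟨z, hz⟩ := hu i
      exact ⟨z + y, by simp [hy, hz]⟩
  have hAnat : ∀ n, ∃ z : ℕ, A n = z := by
    intro n
    obtain ⟨z, hz⟩ := hlistnat (List.range' (s n) (s (n + 1) - s n))
    refine ⟨z, ?_⟩
    rw [← hz, reflTransGen_sum (hblock n)]
    simp
  refine ⟨?_, hAnat⟩
  choose B hB using hAnat
  have hAB : A = fun i => (B i : ℚ) := funext hB
  have hBpos : ∀ n, 0 < B n := fun n => by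
    have := hA n
    rw [hB] at this
    exact_mod_cast this
  have hpm := prefixMat_contraction h0 hs hblock
  have hA1 : ∀ n, 1 ≤ A n := fun n => by rw [hB]; exact_mod_cast hBpos n
  rw [hAB]
  refine hasRegCF_of_sign hBpos fun n => ?_
  rw [← hAB]
  have hQ : 0 < (den A n : ℝ) := by exact_mod_cast den_pos hA1 n
  by_contra! hneg
  obtain ⟨j, hj, hdj, hjx⟩ := hx (s n) _ (div_pos (neg_pos.2 hneg) hQ)
  have hsgn : 0 ≤ (-1 : ℚ) ^ n * (den A n * num u j - num A n * den u j) := by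
    have hW := prefixMat_add u (s n) (j - s n)
    rw [Nat.add_sub_cancel' hj, ← hpm n] at hW
    set W := listMat ((List.range' (s n) (j - s n)).map u)
    have hW10 : 0 ≤ W 1 0 := listMat_nonneg (by
      intro y hy
      obtain ⟨i, -, rfl⟩ := List.mem_map.1 hy
      obtain ⟨z, hz⟩ := hu i
      rw [hz]; positivity) 1 0
    have hnum : num u j = num A n * W 0 0 + prefixMat A n 1 1 * W 1 0 := by
      rw [num, hW, Matrix.mul_apply, Fin.sum_univ_two]; rfl
    have hden : den u j = den A n * W 0 0 + prefixMat A n 0 1 * W 1 0 := by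
      rw [den, hW, Matrix.mul_apply, Fin.sum_univ_two]; rfl
    have hdet : den A n * prefixMat A n 1 1 - num A n * prefixMat A n 0 1 = (-1) ^ n := by
      cases n with
      | zero => simp [den, num, prefixMat_zero]
      | succ n =>
        rw [prefixMat_succ_apply_one, prefixMat_succ_apply_one, pow_succ, ← den_mul_num_sub A n]
        simp only [den, num]
        ring
    have : (-1 : ℚ) ^ n * (den A n * num u j - num A n * den u j) =
        W 1 0 * ((-1) ^ n * (-1) ^ n) := by
      rw [hnum, hden]
      linear_combination (-1 : ℚ) ^ n * W 1 0 * hdet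
    rw [this, ← mul_pow]
    simpa using hW10
  have hsgn' : 0 ≤ (-1 : ℝ) ^ n * ((den A n : ℝ) * ((num u j / den u j : ℚ) : ℝ) - num A n) := by
    have : (-1 : ℚ) ^ n * (den A n * (num u j / den u j) - num A n) =
        (-1 : ℚ) ^ n * (den A n * num u j - num A n * den u j) / den u j := by
      field_simp
    have h2 : 0 ≤ (-1 : ℚ) ^ n * (den A n * (num u j / den u j) - num A n) := by
      rw [this]; positivity
    exact_mod_cast h2
  rw [lt_div_iff₀ hQ] at hjx
  set y := ((num u j / den u j : ℚ) : ℝ)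
  have habs : |(-1 : ℝ) ^ n * ((den A n : ℝ) * (y - x))| = |y - x| * den A n := by
    rw [abs_mul, abs_mul, abs_pow, abs_of_pos hQ]; simp [mul_comm]
  have := le_abs_self ((-1 : ℝ) ^ n * ((den A n : ℝ) * (y - x)))
  rw [habs] at this
  have e : (-1 : ℝ) ^ n * ((den A n : ℝ) * y - num A n) =
      (-1 : ℝ) ^ n * ((den A n : ℝ) * x - num A n) + (-1 : ℝ) ^ n * ((den A n : ℝ) * (y - x)) := by
    ring
  linarith

/-! ### Admissible digits and the words of the convergents -/

/-- Positive partial quotients `a k`, and digits satisfying the Ostrowski conditions. -/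
structure AdmissibleDigits (a β : ℕ → ℕ) : Prop where
  one_le : ∀ k, 1 ≤ k → 1 ≤ a k
  first : β 1 < a 1
  le : ∀ k, 1 ≤ k → β k ≤ a k
  rule : ∀ k, 1 ≤ k → β (k + 1) = a (k + 1) → β k = 0

section Lengths

theorem q_succ (a : ℕ → ℕ) (k : ℕ) : q a (k + 1) = a (k + 1) * q a k + qPrev a k := by
  cases k <;> simp [q, qPrev]

theorem t_zero (a β : ℕ → ℕ) : t a β 0 = 0 := by simp [t]

theorem t_succ (a β : ℕ → ℕ) (k : ℕ) : t a β (k + 1) = t a β k + β (k + 1) * q a k := by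
  simp [t, Finset.sum_range_succ]

variable {a β : ℕ → ℕ}

theorem q_pos (ha : ∀ k, 1 ≤ k → 1 ≤ a k) (k : ℕ) : 0 < q a k := by
  induction k with
  | zero => simp [q]
  | succ k ih =>
    have := ha (k + 1) (by omega)
    rw [q_succ]; positivity

theorem q_le_succ (ha : ∀ k, 1 ≤ k → 1 ≤ a k) (k : ℕ) : q a k ≤ q a (k + 1) := by
  rw [q_succ]
  nlinarith [ha (k + 1) (by omega), Nat.zero_le (qPrev a k)]

theorem AdmissibleDigits.t_lt (h : AdmissibleDigits a β) (k : ℕ) : t a β k < q a k := by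
  induction k using Nat.twoStepInduction with
  | zero => simp [t, q]
  | one => simpa [t_succ, t_zero, q] using h.first
  | more k ih1 ih2 =>
    rw [t_succ, q]
    rcases (h.le (k + 2) (by omega)).lt_or_eq with hlt | heq
    · have : (β (k + 2) + 1) * q a (k + 1) ≤ a (k + 2) * q a (k + 1) :=
        Nat.mul_le_mul_right _ hlt
      rw [add_mul] at this
      change t a β (k + 1) + β (k + 2) * q a (k + 1) < _
      omega
    · rw [t_succ, h.rule (k + 1) (by omega) heq, heq]
      omega

theorem AdmissibleDigits.r_pos (h : AdmissibleDigits a β) (k : ℕ) : 0 < r a β k := by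
  have := h.t_lt k
  rw [r]; omega

theorem AdmissibleDigits.r_eq (h : AdmissibleDigits a β) (k : ℕ) :
    r a β k = ((q a k - t a β k : ℕ) : ℤ) := by
  have := h.t_lt k
  rw [r]; omega

theorem r_succ (k : ℕ) : r a β (k + 1) =
    r a β k + qPrev a k + ((a (k + 1) : ℤ) - β (k + 1) - 1) * q a k := by
  simp only [r, q_succ, t_succ]
  push_cast
  ring

end Lengths

section Words

/-- The word `w` repeated `n` times. -/
def repeatWord (n : ℕ) (w : List ℕ) : List ℕ := (List.replicate n w).flatten

theorem repeatWord_add (m n : ℕ) (w : List ℕ) :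
    repeatWord (m + n) w = repeatWord m w ++ repeatWord n w := by
  rw [repeatWord, ← List.replicate_append_replicate, List.flatten_append]
  rfl

theorem repeatWord_zero (w : List ℕ) : repeatWord 0 w = [] := rfl

theorem repeatWord_succ (n : ℕ) (w : List ℕ) : repeatWord (n + 1) w = w ++ repeatWord n w := by
  simp [repeatWord, List.replicate_succ]

theorem length_repeatWord (n : ℕ) (w : List ℕ) : (repeatWord n w).length = n * w.length := by
  simp [repeatWord]

theorem append_repeatWord_append (n : ℕ) (v w : List ℕ) :
    v ++ repeatWord n (w ++ v) = repeatWord n (v ++ w) ++ v := by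
  induction n with
  | zero => simp [repeatWord_zero]
  | succ n ih => rw [repeatWord_succ, repeatWord_succ, List.append_assoc, ih]; simp

theorem M_add_two (a : ℕ → ℕ) (k : ℕ) :
    M a (k + 2) = repeatWord (a (k + 2)) (M a (k + 1)) ++ M a k := rfl

variable {a β : ℕ → ℕ}

theorem length_M (ha : 1 ≤ a 1) (k : ℕ) : (M a k).length = q a k := by
  induction k using Nat.twoStepInduction with
  | zero => rfl
  | one => simp [M, q]; omega
  | more k ih1 ih2 => rw [M_add_two, List.length_append, length_repeatWord, ih1, ih2, q]

theorem T_append_R (a β : ℕ → ℕ) (k : ℕ) : T a β k ++ R a β k = M a k :=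
  List.take_append_drop _ _

theorem AdmissibleDigits.length_T (h : AdmissibleDigits a β) (k : ℕ) :
    (T a β k).length = t a β k := by
  rw [T, List.length_take, length_M (h.one_le 1 le_rfl)]
  exact min_eq_left (h.t_lt k).le

theorem AdmissibleDigits.length_R (h : AdmissibleDigits a β) (k : ℕ) :
    (R a β k).length = q a k - t a β k := by
  rw [R, List.length_drop, length_M (h.one_le 1 le_rfl)]

/-- If `β (k + 1) = a (k + 1)`, then `T (k + 1)` reaches into the last factor `M (k - 1)` of
`M (k + 1)`; the formula persists because then `β k = 0` and `T k = T (k - 1)`. -/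
theorem AdmissibleDigits.T_succ (h : AdmissibleDigits a β) (k : ℕ) :
    T a β (k + 1) = repeatWord (β (k + 1)) (M a k) ++ T a β k := by
  induction k with
  | zero =>
    have h1 := h.first
    have : repeatWord (β 1) [0] = List.replicate (β 1) 0 := by
      induction β 1 with
      | zero => rfl
      | succ n ih => rw [repeatWord_succ, ih]; rfl
    simp only [T, M, t_succ, t_zero, q, zero_add, mul_one, this]
    rw [List.take_append_of_le_length (by simp; omega), List.take_replicate]
    simp
    omega
  | succ k ih =>
    have hl : (M a (k + 1)).length = q a (k + 1) := length_M (h.one_le 1 le_rfl) _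
    have hlen : (repeatWord (β (k + 2)) (M a (k + 1))).length = β (k + 2) * q a (k + 1) := by
      rw [length_repeatWord, hl]
    obtain ⟨n, hn⟩ := Nat.exists_eq_add_of_le (h.le (k + 2) (by omega))
    rw [T, t_succ, add_comm (t a β (k + 1)), M_add_two, hn, repeatWord_add, List.append_assoc,
      ← hlen, List.take_length_add_append]
    congr 1
    rcases n with _ | n
    · have h0 := h.rule (k + 1) (by omega) hn.symm
      rw [ih, h0, t_succ, h0]
      simp [repeatWord_zero, T]
    · rw [repeatWord_succ, List.append_assoc,
        List.take_append_of_le_length (by rw [hl]; exact (h.t_lt _).le)]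
      rfl

theorem AdmissibleDigits.T_append_R_succ (h : AdmissibleDigits a β) (k : ℕ) :
    T a β (k + 1) ++ R a β (k + 2) =
      repeatWord (a (k + 2) - β (k + 2)) (M a (k + 1)) ++ M a k := by
  have h1 := T_append_R a β (k + 2)
  obtain ⟨n, hn⟩ := Nat.exists_eq_add_of_le (h.le (k + 2) (by omega))
  rw [h.T_succ, M_add_two, hn, repeatWord_add, List.append_assoc, List.append_assoc] at h1
  rw [List.append_cancel_left h1, hn, Nat.add_sub_cancel_left]

end Words

section Values

variable (b : ℕ)

theorem val_nil : val b [] = 0 := by simp [val]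

theorem val_append (v w : List ℕ) : val b (v ++ w) = val b v * (b : ℚ) ^ w.length + val b w := by
  simp only [val, List.reverse_append, List.map_append, Nat.ofDigits_append, List.length_map,
    List.length_reverse]
  push_cast
  ring

theorem val_singleton (x : ℕ) : val b [x] = (((b - 1) * x : ℕ) : ℚ) := by simp [val]

theorem val_replicate_zero (n : ℕ) : val b (List.replicate n 0) = 0 := by
  induction n with
  | zero => exact val_nil b
  | succ n ih => rw [List.replicate_succ', val_append, ih, val_singleton]; simp

theorem val_repeatWord (n : ℕ) (w : List ℕ) :
    val b (repeatWord n w) * ((b : ℚ) ^ w.length - 1) =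
      val b w * ((b : ℚ) ^ (n * w.length) - 1) := by
  induction n with
  | zero => simp [repeatWord_zero, val_nil]
  | succ n ih =>
    rw [repeatWord_succ, val_append, length_repeatWord, add_mul, ih]
    ring

end Values

/-! ### The recursion between the five types of fractions -/

section Recursion

variable {b : ℕ} {a β : ℕ → ℕ}

/-- The numerator of the fraction `(3)` with index `k - 1`. The value `b - 1` at `k = 0` makes the
recursion start with `b - 1` times the identity matrix. -/
def prevNum (b : ℕ) (a β : ℕ → ℕ) : ℕ → ℚ
  | 0 => (b : ℚ) - 1
  | k + 1 => val b (R a β (k + 1) ++ M a k) - val b (R a β (k + 1))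

theorem pow_q_ne_one (hb : 2 ≤ b) (ha : ∀ k, 1 ≤ k → 1 ≤ a k) (k : ℕ) :
    (b : ℚ) ^ q a k - 1 ≠ 0 := by
  have : 1 < (b : ℚ) ^ q a k :=
    one_lt_pow₀ (by exact_mod_cast hb) (q_pos ha k).ne'
  linarith

/-- `c k` without division; the right-hand side makes sense also if `β (k + 1) = a (k + 1)`. -/
theorem cSeq_mul (hb : 2 ≤ b) (ha : ∀ k, 1 ≤ k → 1 ≤ a k) (k : ℕ) :
    cSeq b a β k * ((b : ℚ) ^ q a k - 1) =
      (b : ℚ) ^ r a β (k + 1) - (b : ℚ) ^ (r a β k + (qPrev a k : ℤ)) := by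
  have hb0 : (b : ℚ) ≠ 0 := by positivity
  rw [cSeq, mul_assoc, div_mul_cancel₀ _ (pow_q_ne_one hb ha k), r_succ, zpow_add₀ hb0 _ (_ * _)]
  ring

theorem fSeq_mul (hb : 2 ≤ b) (ha : ∀ k, 1 ≤ k → 1 ≤ a k) (k : ℕ) :
    fSeq b a β k * ((b : ℚ) ^ q a k - 1) =
      (b : ℚ) ^ t a β k * ((b : ℚ) ^ (β (k + 1) * q a k) - 1) := by
  rw [fSeq, mul_assoc, div_mul_cancel₀ _ (pow_q_ne_one hb ha k)]

theorem zpow_q (hb : 2 ≤ b) (k : ℕ) :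
    (b : ℚ) ^ q a k = (b : ℚ) ^ t a β k * (b : ℚ) ^ r a β k := by
  have hb0 : (b : ℚ) ≠ 0 := by positivity
  rw [← zpow_natCast, ← zpow_natCast, ← zpow_add₀ hb0, r]
  congr 1; ring

theorem AdmissibleDigits.pow_length_R (h : AdmissibleDigits a β) (k : ℕ) :
    (b : ℚ) ^ (R a β k).length = (b : ℚ) ^ r a β k := by
  rw [h.length_R, h.r_eq, zpow_natCast]

/-- The step from `(4)`, `(3)` to `(1)`; for `k ≥ 1`, the identity of words
`R_k T_k R_{k+1} = R_k M_k^n M_{k-1}`, with `n = a (k + 1) - β (k + 1)`, also covers `n = 0`, where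
`c k` is negative. -/
theorem AdmissibleDigits.num1_eq (h : AdmissibleDigits a β) (hb : 2 ≤ b) (k : ℕ) :
    val b (R a β (k + 1)) - val b (R a β k) =
      val b (R a β k ++ T a β k) * cSeq b a β k + prevNum b a β k := by
  have hb0 : (b : ℚ) ≠ 0 := by positivity
  rcases k with _ | k
  · have h1 := h.first
    have hR : R a β 1 = List.replicate (a 1 - 1 - β 1) 0 ++ [1] := by
      rw [R, M, t_succ, t_zero, List.drop_append_of_le_length (by simp [q]; omega)]
      simp [q]
    have hR0 : R a β 0 = [0] := by simp [R, t_zero, M]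
    have hT0 : T a β 0 = [] := by simp [T, t_zero]
    rw [hR, hR0, hT0, val_append, val_replicate_zero, prevNum]
    simp only [val_singleton, List.append_nil]
    push_cast [Nat.cast_sub (show 1 ≤ b by omega)]
    ring
  · obtain ⟨n, hn⟩ := Nat.exists_eq_add_of_le (h.le (k + 2) (by omega))
    have hw : (R a β (k + 1) ++ T a β (k + 1)) ++ R a β (k + 2) =
        repeatWord n (R a β (k + 1) ++ T a β (k + 1)) ++ (R a β (k + 1) ++ M a k) := by
      have := append_repeatWord_append n (R a β (k + 1)) (T a β (k + 1))
      rw [T_append_R] at this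
      rw [List.append_assoc, h.T_append_R_succ, hn, Nat.add_sub_cancel_left, ← List.append_assoc,
        this, List.append_assoc]
    have hv := congrArg (val b) hw
    have hlenV : (R a β (k + 1) ++ T a β (k + 1)).length = q a (k + 1) := by
      have := h.t_lt (k + 1)
      rw [List.length_append, h.length_R, h.length_T]; omega
    rw [val_append b (_ ++ _) (R a β (k + 2)), val_append b (repeatWord _ _), h.pow_length_R] at hv
    have hrep := val_repeatWord b n (R a β (k + 1) ++ T a β (k + 1))
    rw [hlenV] at hrep
    have hlen2 : (b : ℚ) ^ (R a β (k + 1) ++ M a k).length =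
        (b : ℚ) ^ (r a β (k + 1) + (qPrev a (k + 1) : ℤ)) := by
      rw [List.length_append, pow_add, h.pow_length_R, length_M (h.one_le 1 le_rfl),
        zpow_add₀ hb0, zpow_natCast]
      rfl
    rw [hlen2] at hv
    have hc := cSeq_mul (β := β) hb h.one_le (k + 1)
    have hpow : (b : ℚ) ^ (n * q a (k + 1)) * (b : ℚ) ^ (r a β (k + 1) + (qPrev a (k + 1) : ℤ)) =
        (b : ℚ) ^ r a β (k + 2) * (b : ℚ) ^ q a (k + 1) := by
      rw [← zpow_natCast, ← zpow_natCast, ← zpow_add₀ hb0, ← zpow_add₀ hb0, r_succ (k + 1), hn]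
      congr 1
      push_cast
      ring
    refine mul_right_cancel₀ (pow_q_ne_one hb h.one_le (k + 1)) ?_
    rw [prevNum]
    linear_combination ((b : ℚ) ^ q a (k + 1) - 1) * hv +
      (b : ℚ) ^ (r a β (k + 1) + (qPrev a (k + 1) : ℤ)) * hrep +
      val b (R a β (k + 1) ++ T a β (k + 1)) * hpow -
      val b (R a β (k + 1) ++ T a β (k + 1)) * hc

theorem den1_eq (hb : 2 ≤ b) (ha : ∀ k, 1 ≤ k → 1 ≤ a k) (k : ℕ) :
    (b : ℚ) ^ r a β (k + 1) - (b : ℚ) ^ r a β k =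
      ((b : ℚ) ^ q a k - 1) * cSeq b a β k +
        (b : ℚ) ^ r a β k * ((b : ℚ) ^ qPrev a k - 1) := by
  have hb0 : (b : ℚ) ≠ 0 := by positivity
  have := cSeq_mul (β := β) hb ha k
  rw [zpow_add₀ hb0, zpow_natCast] at this
  linear_combination -this

theorem AdmissibleDigits.num21_eq (h : AdmissibleDigits a β) (k : ℕ) :
    val b (R a β (k + 1) ++ T a β k) - (val b (R a β (k + 1)) - val b (R a β k)) =
      (val b (R a β (k + 1)) - val b (R a β k)) * dSeq b a β k +
        val b (R a β k ++ T a β k) := by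
  rw [val_append, val_append, h.length_T, dSeq]
  ring

theorem den21_eq (hb : 2 ≤ b) (k : ℕ) :
    (b : ℚ) ^ (r a β (k + 1) + (t a β k : ℤ)) - 1 -
      ((b : ℚ) ^ r a β (k + 1) - (b : ℚ) ^ r a β k) =
      ((b : ℚ) ^ r a β (k + 1) - (b : ℚ) ^ r a β k) * dSeq b a β k +
        ((b : ℚ) ^ q a k - 1) := by
  have hb0 : (b : ℚ) ≠ 0 := by positivity
  rw [zpow_add₀ hb0, zpow_natCast, dSeq, zpow_q (β := β) hb]
  ring

theorem AdmissibleDigits.num3_eq (h : AdmissibleDigits a β) (k : ℕ) :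
    prevNum b a β (k + 1) = val b (R a β (k + 1) ++ T a β k) * eSeq b a β k +
      (val b (R a β (k + 1) ++ T a β k) - (val b (R a β (k + 1)) - val b (R a β k))) := by
  rw [prevNum, ← T_append_R a β k, ← List.append_assoc, val_append b (_ ++ _), h.pow_length_R,
    eSeq]
  ring

theorem den3_eq (hb : 2 ≤ b) (k : ℕ) :
    (b : ℚ) ^ r a β (k + 1) * ((b : ℚ) ^ q a k - 1) =
      ((b : ℚ) ^ (r a β (k + 1) + (t a β k : ℤ)) - 1) * eSeq b a β k +
      ((b : ℚ) ^ (r a β (k + 1) + (t a β k : ℤ)) - 1 -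
        ((b : ℚ) ^ r a β (k + 1) - (b : ℚ) ^ r a β k)) := by
  have hb0 : (b : ℚ) ≠ 0 := by positivity
  rw [zpow_add₀ hb0, zpow_natCast, eSeq, zpow_q (β := β) hb]
  ring

theorem AdmissibleDigits.num4_eq (h : AdmissibleDigits a β) (hb : 2 ≤ b) (k : ℕ) :
    val b (R a β (k + 1) ++ T a β (k + 1)) =
      prevNum b a β (k + 1) * fSeq b a β k + val b (R a β (k + 1) ++ T a β k) := by
  have hf := fSeq_mul (β := β) hb h.one_le k
  have hl := length_M (h.one_le 1 le_rfl) k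
  have hrep := val_repeatWord b (β (k + 1)) (M a k)
  rw [hl] at hrep
  rw [h.T_succ, ← List.append_assoc, val_append b (_ ++ _), val_append b _ (T a β k), val_append,
    prevNum, val_append, length_repeatWord, hl, h.length_T]
  refine mul_right_cancel₀ (pow_q_ne_one hb h.one_le k) ?_
  linear_combination (b : ℚ) ^ t a β k * hrep -
    (val b (R a β (k + 1)) * ((b : ℚ) ^ q a k - 1) + val b (M a k)) * hf

theorem den4_eq (hb : 2 ≤ b) (ha : ∀ k, 1 ≤ k → 1 ≤ a k) (k : ℕ) :
    (b : ℚ) ^ q a (k + 1) - 1 =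
      (b : ℚ) ^ r a β (k + 1) * ((b : ℚ) ^ q a k - 1) * fSeq b a β k +
        ((b : ℚ) ^ (r a β (k + 1) + (t a β k : ℤ)) - 1) := by
  have hb0 : (b : ℚ) ≠ 0 := by positivity
  have hf := fSeq_mul (β := β) hb ha k
  rw [zpow_q (β := β) hb, t_succ, pow_add, zpow_add₀ hb0, zpow_natCast]
  linear_combination -(b : ℚ) ^ r a β (k + 1) * hf

theorem improper_five_mul (k : ℕ) : improper b a β (5 * k) = cSeq b a β k := by
  simp [improper]

theorem improper_five_mul_add_one (k : ℕ) : improper b a β (5 * k + 1) = dSeq b a β k := by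
  simp [improper, show (5 * k + 1) / 5 = k by omega]

theorem improper_five_mul_add_two (k : ℕ) : improper b a β (5 * k + 2) = 1 := by
  simp [improper]

theorem improper_five_mul_add_three (k : ℕ) : improper b a β (5 * k + 3) = eSeq b a β k := by
  simp [improper, show (5 * k + 3) / 5 = k by omega]

theorem improper_five_mul_add_four (k : ℕ) : improper b a β (5 * k + 4) = fSeq b a β k := by
  simp [improper, show (5 * k + 4) / 5 = k by omega]

theorem mul_stepMat (A B C D x : ℚ) :
    !![A, B; C, D] * stepMat x = !![A * x + B, A; C * x + D, C] := by
  ext i j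
  fin_cases i <;> fin_cases j <;> simp [stepMat, Matrix.mul_apply, Fin.sum_univ_two]

/-- The five consecutive matrices of the improper expansion, multiplied by `b - 1`; their columns
are the numerators and denominators of the five types of fractions. -/
theorem AdmissibleDigits.prefixMat_improper_succ (h : AdmissibleDigits a β) (hb : 2 ≤ b) (k : ℕ)
    (hk : ((b : ℚ) - 1) • prefixMat (improper b a β) (5 * k) =
      !![(b : ℚ) ^ q a k - 1, (b : ℚ) ^ r a β k * ((b : ℚ) ^ qPrev a k - 1);
        val b (R a β k ++ T a β k), prevNum b a β k]) :
    ((b : ℚ) - 1) • prefixMat (improper b a β) (5 * k + 1) =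
      !![(b : ℚ) ^ r a β (k + 1) - (b : ℚ) ^ r a β k, (b : ℚ) ^ q a k - 1;
        val b (R a β (k + 1)) - val b (R a β k), val b (R a β k ++ T a β k)] ∧
    ((b : ℚ) - 1) • prefixMat (improper b a β) (5 * k + 2) =
      !![(b : ℚ) ^ (r a β (k + 1) + (t a β k : ℤ)) - 1 -
          ((b : ℚ) ^ r a β (k + 1) - (b : ℚ) ^ r a β k),
          (b : ℚ) ^ r a β (k + 1) - (b : ℚ) ^ r a β k;
        val b (R a β (k + 1) ++ T a β k) - (val b (R a β (k + 1)) - val b (R a β k)),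
          val b (R a β (k + 1)) - val b (R a β k)] ∧
    ((b : ℚ) - 1) • prefixMat (improper b a β) (5 * k + 3) =
      !![(b : ℚ) ^ (r a β (k + 1) + (t a β k : ℤ)) - 1,
          (b : ℚ) ^ (r a β (k + 1) + (t a β k : ℤ)) - 1 -
            ((b : ℚ) ^ r a β (k + 1) - (b : ℚ) ^ r a β k);
        val b (R a β (k + 1) ++ T a β k),
          val b (R a β (k + 1) ++ T a β k) - (val b (R a β (k + 1)) - val b (R a β k))] ∧
    ((b : ℚ) - 1) • prefixMat (improper b a β) (5 * k + 4) =
      !![(b : ℚ) ^ r a β (k + 1) * ((b : ℚ) ^ q a k - 1),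
          (b : ℚ) ^ (r a β (k + 1) + (t a β k : ℤ)) - 1;
        prevNum b a β (k + 1), val b (R a β (k + 1) ++ T a β k)] ∧
    ((b : ℚ) - 1) • prefixMat (improper b a β) (5 * (k + 1)) =
      !![(b : ℚ) ^ q a (k + 1) - 1,
          (b : ℚ) ^ r a β (k + 1) * ((b : ℚ) ^ qPrev a (k + 1) - 1);
        val b (R a β (k + 1) ++ T a β (k + 1)), prevNum b a β (k + 1)] := by
  have step : ∀ (n : ℕ) (A B C D : ℚ),
      ((b : ℚ) - 1) • prefixMat (improper b a β) n = !![A, B; C, D] →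
      ((b : ℚ) - 1) • prefixMat (improper b a β) (n + 1) =
        !![A * improper b a β n + B, A; C * improper b a β n + D, C] := by
    intro n A B C D hn
    rw [prefixMat_succ, ← Matrix.smul_mul, hn, mul_stepMat]
  have h1 := step _ _ _ _ _ hk
  rw [improper_five_mul, ← den1_eq hb h.one_le, ← h.num1_eq hb] at h1
  have h2 := step _ _ _ _ _ h1
  rw [improper_five_mul_add_one, ← den21_eq hb, ← h.num21_eq] at h2
  have h3 := step _ _ _ _ _ h2
  rw [improper_five_mul_add_two, mul_one, mul_one, sub_add_cancel, sub_add_cancel] at h3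
  have h4 := step _ _ _ _ _ h3
  rw [improper_five_mul_add_three, ← den3_eq hb, ← h.num3_eq] at h4
  have h5 := step _ _ _ _ _ h4
  rw [improper_five_mul_add_four, ← den4_eq hb h.one_le, ← h.num4_eq hb] at h5
  exact ⟨h1, h2, h3, h4, h5⟩

theorem AdmissibleDigits.prefixMat_improper (h : AdmissibleDigits a β) (hb : 2 ≤ b) (k : ℕ) :
    ((b : ℚ) - 1) • prefixMat (improper b a β) (5 * k) =
      !![(b : ℚ) ^ q a k - 1, (b : ℚ) ^ r a β k * ((b : ℚ) ^ qPrev a k - 1);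
        val b (R a β k ++ T a β k), prevNum b a β k] := by
  induction k with
  | zero =>
    simp only [mul_zero, prefixMat_zero, q, qPrev, pow_zero, sub_self, R, T, t_zero, M, prevNum,
      pow_one]
    ext i j
    fin_cases i <;> fin_cases j <;> simp [val_singleton]
  | succ k ih => exact (h.prefixMat_improper_succ hb k ih).2.2.2.2

theorem num_div_den_of_smul (hb : 2 ≤ b) {u : ℕ → ℚ} {n : ℕ} {A B C D : ℚ}
    (h : ((b : ℚ) - 1) • prefixMat u n = !![A, B; C, D]) : num u n / den u n = C / A := by
  have hb1 : (b : ℚ) - 1 ≠ 0 := by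
    have : (2 : ℚ) ≤ b := by exact_mod_cast hb
    linarith
  have hA : ((b : ℚ) - 1) * den u n = A := congrFun (congrFun h 0) 0
  have hC : ((b : ℚ) - 1) * num u n = C := congrFun (congrFun h 1) 0
  rw [← hA, ← hC, mul_div_mul_left _ _ hb1]

/-- The convergents of the improper expansion. -/
theorem AdmissibleDigits.improper_convergents (h : AdmissibleDigits a β) (hb : 2 ≤ b) (k : ℕ) :
    num (improper b a β) (5 * k + 1) / den (improper b a β) (5 * k + 1) = conv1 b a β k ∧
    num (improper b a β) (5 * k + 2) / den (improper b a β) (5 * k + 2) = conv21 b a β k ∧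
    num (improper b a β) (5 * k + 3) / den (improper b a β) (5 * k + 3) = conv2 b a β k ∧
    num (improper b a β) (5 * k + 4) / den (improper b a β) (5 * k + 4) = conv3 b a β k ∧
    num (improper b a β) (5 * k + 5) / den (improper b a β) (5 * k + 5) = conv4 b a β k := by
  obtain ⟨h1, h2, h3, h4, h5⟩ := h.prefixMat_improper_succ hb k (h.prefixMat_improper hb k)
  exact ⟨num_div_den_of_smul hb h1, num_div_den_of_smul hb h2, num_div_den_of_smul hb h3,
    num_div_den_of_smul hb h4, num_div_den_of_smul hb h5⟩

end Recursion

/-! ### The signs of the terms and rule (i) -/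

section Terms

variable {b : ℕ} {a β : ℕ → ℕ}

theorem one_lt_pow_q (hb : 2 ≤ b) (ha : ∀ k, 1 ≤ k → 1 ≤ a k) (k : ℕ) :
    1 < (b : ℚ) ^ q a k :=
  one_lt_pow₀ (by exact_mod_cast hb) (q_pos ha k).ne'

theorem AdmissibleDigits.cSeq_nat (h : AdmissibleDigits a β) (hb : 2 ≤ b) {k : ℕ}
    (hk : β (k + 1) < a (k + 1)) : ∃ z : ℕ, cSeq b a β k = z := by
  obtain ⟨n, hn⟩ := Nat.exists_eq_add_of_le (Nat.succ_le_of_lt hk)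
  refine ⟨b ^ (q a k - t a β k + qPrev a k) * ∑ i ∈ Finset.range n, (b ^ q a k) ^ i, ?_⟩
  have h1 := one_lt_pow_q hb h.one_le k
  rw [cSeq, h.r_eq, ← Nat.cast_add, zpow_natCast, hn]
  push_cast
  rw [geom_sum_eq h1.ne', ← pow_mul, mul_comm (q a k) n]
  congr 3
  rw [← zpow_natCast]
  congr 1
  push_cast
  ring

theorem AdmissibleDigits.cSeq_neg_iff (h : AdmissibleDigits a β) (hb : 2 ≤ b) {k : ℕ} :
    cSeq b a β k < 0 ↔ β (k + 1) = a (k + 1) := by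
  constructor
  · intro hneg
    by_contra hne
    obtain ⟨z, hz⟩ := h.cSeq_nat hb (lt_of_le_of_ne (h.le (k + 1) (by omega)) hne)
    rw [hz] at hneg
    exact absurd hneg (not_lt.2 (Nat.cast_nonneg z))
  · intro heq
    have hb0 : (0 : ℚ) < b := by positivity
    have h1 := one_lt_pow_q hb h.one_le k
    have h2 := cSeq_mul (β := β) hb h.one_le k
    rw [r_succ, heq, sub_self, zero_sub, zpow_add₀ hb0.ne' _ (-1 * _), neg_one_mul, zpow_neg,
      zpow_natCast] at h2
    have h3 : ((b : ℚ) ^ q a k)⁻¹ < 1 := inv_lt_one_of_one_lt₀ h1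
    have h4 : 0 < (b : ℚ) ^ (r a β k + (qPrev a k : ℤ)) := zpow_pos hb0 _
    nlinarith

theorem dSeq_nat (k : ℕ) (hb : 2 ≤ b) : ∃ z : ℕ, dSeq b a β k = z := by
  refine ⟨b ^ t a β k - 1, ?_⟩
  rw [dSeq, Nat.cast_sub (Nat.one_le_pow _ _ (by omega))]
  push_cast; rfl

theorem dSeq_pos (hb : 2 ≤ b) {k : ℕ} (hk : 0 < t a β k) : 0 < dSeq b a β k := by
  have : 1 < (b : ℚ) ^ t a β k := one_lt_pow₀ (by exact_mod_cast hb) hk.ne'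
  rw [dSeq]; linarith

theorem dSeq_eq_zero {k : ℕ} (hk : t a β k = 0) : dSeq b a β k = 0 := by simp [dSeq, hk]

theorem AdmissibleDigits.eSeq_nat (h : AdmissibleDigits a β) (hb : 2 ≤ b) (k : ℕ) :
    ∃ z : ℕ, eSeq b a β k = z := by
  refine ⟨b ^ (q a k - t a β k) - 1, ?_⟩
  rw [eSeq, h.r_eq, zpow_natCast, Nat.cast_sub (Nat.one_le_pow _ _ (by omega))]
  push_cast; rfl

theorem AdmissibleDigits.eSeq_pos (h : AdmissibleDigits a β) (hb : 2 ≤ b) (k : ℕ) :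
    0 < eSeq b a β k := by
  have : 1 < (b : ℚ) ^ r a β k := one_lt_zpow₀ (by exact_mod_cast hb) (h.r_pos k)
  rw [eSeq]; linarith

theorem fSeq_nat (hb : 2 ≤ b) (ha : ∀ k, 1 ≤ k → 1 ≤ a k) (k : ℕ) :
    ∃ z : ℕ, fSeq b a β k = z := by
  refine ⟨b ^ t a β k * ∑ i ∈ Finset.range (β (k + 1)), (b ^ q a k) ^ i, ?_⟩
  have h1 := one_lt_pow_q hb ha k
  rw [fSeq]
  push_cast
  rw [geom_sum_eq h1.ne', ← pow_mul, mul_comm (q a k)]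

theorem fSeq_eq_zero {k : ℕ} (hk : β (k + 1) = 0) : fSeq b a β k = 0 := by simp [fSeq, hk]

theorem fSeq_pos (hb : 2 ≤ b) (ha : ∀ k, 1 ≤ k → 1 ≤ a k) {k : ℕ} (hk : 0 < β (k + 1)) :
    0 < fSeq b a β k := by
  have h1 := one_lt_pow_q hb ha k
  have h2 : 1 < (b : ℚ) ^ (β (k + 1) * q a k) :=
    one_lt_pow₀ (by exact_mod_cast hb) (Nat.mul_pos hk (q_pos ha k)).ne'
  have hb0 : (0 : ℚ) < b := by positivity
  rw [fSeq]
  exact mul_pos (pow_pos hb0 _) (div_pos (by linarith) (by linarith))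

/-- When `β (k + 2) = a (k + 2)`, the negative term `c (k + 1)` cancels `e k`. -/
theorem AdmissibleDigits.cSeq_of_eq (h : AdmissibleDigits a β) (hb : 2 ≤ b) {k : ℕ}
    (hk : β (k + 2) = a (k + 2)) : cSeq b a β (k + 1) = -(eSeq b a β k + 1) := by
  have hb0 : (b : ℚ) ≠ 0 := by positivity
  have h0 := h.rule (k + 1) (by omega) hk
  have h2 := cSeq_mul (β := β) hb h.one_le (k + 1)
  have e1 : r a β (k + 1 + 1) = r a β k := by
    rw [r_succ, r, r, t_succ, h0, hk, qPrev]; push_cast; ring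
  have e2 : r a β (k + 1) + (qPrev a (k + 1) : ℤ) = r a β k + (q a (k + 1) : ℤ) := by
    rw [r, r, t_succ, h0, qPrev]; push_cast; ring
  rw [e1, e2, zpow_add₀ hb0, zpow_natCast] at h2
  refine mul_right_cancel₀ (pow_q_ne_one hb h.one_le (k + 1)) ?_
  rw [h2, eSeq]
  ring

end Terms

section Merge

variable {b : ℕ} {a β : ℕ → ℕ}

theorem mergePos_succ_of_merge {n : ℕ} (h : MergeAt b a β (mergePos b a β n)) :
    mergePos b a β (n + 1) = mergePos b a β n + 9 := if_pos h

theorem mergePos_succ_of_not {n : ℕ} (h : ¬ MergeAt b a β (mergePos b a β n)) :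
    mergePos b a β (n + 1) = mergePos b a β n + 1 := if_neg h

theorem merged_of_merge {n : ℕ} (h : MergeAt b a β (mergePos b a β n)) :
    merged b a β n = cSeq b a β (mergePos b a β n / 5) + 1 +
      eSeq b a β (mergePos b a β n / 5 + 1) := if_pos h

theorem merged_of_not {n : ℕ} (h : ¬ MergeAt b a β (mergePos b a β n)) :
    merged b a β n = improper b a β (mergePos b a β n) := if_neg h

theorem not_mergeAt_of_mod {i : ℕ} (h : i % 5 ≠ 0) : ¬ MergeAt b a β i := fun hm => h hm.1

theorem AdmissibleDigits.mergeAt_iff (h : AdmissibleDigits a β) (hb : 2 ≤ b) (k : ℕ) :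
    MergeAt b a β (5 * k) ↔ β (k + 2) = a (k + 2) := by
  rw [MergeAt, show 5 * k / 5 = k by omega, h.cSeq_neg_iff hb]
  simp

/-- The positions of the improper expansion that survive rule (i) avoid the negative terms. -/
theorem AdmissibleDigits.mergePos_spec (h : AdmissibleDigits a β) (hb : 2 ≤ b) (n : ℕ) :
    ∃ k s, mergePos b a β n = 5 * k + s ∧ s < 5 ∧ (s ≤ 3 → β (k + 1) < a (k + 1)) ∧
      (1 ≤ s → β (k + 2) < a (k + 2)) := by
  induction n with
  | zero => exact ⟨0, 0, rfl, by omega, fun _ => h.first, by omega⟩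
  | succ n ih =>
    obtain ⟨k, s, hi, hs, h1, h2⟩ := ih
    by_cases hm : MergeAt b a β (mergePos b a β n)
    · have hs0 : s = 0 := by have := hm.1; omega
      rw [mergePos_succ_of_merge hm]
      rw [hi, hs0, add_zero, h.mergeAt_iff hb] at hm
      refine ⟨k + 1, 4, by omega, by omega, by omega, fun _ => ?_⟩
      refine lt_of_le_of_ne (h.le _ (by omega)) fun heq => ?_
      have := h.rule (k + 2) (by omega) heq
      have := h.one_le (k + 2) (by omega)
      omega
    · rw [mergePos_succ_of_not hm, hi]
      rcases Nat.lt_or_ge s 4 with hs4 | hs4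
      · refine ⟨k, s + 1, by omega, by omega, fun _ => h1 (by omega), fun _ => ?_⟩
        rcases Nat.eq_zero_or_pos s with rfl | hs0
        · rw [hi, add_zero, h.mergeAt_iff hb] at hm
          exact lt_of_le_of_ne (h.le _ (by omega)) hm
        · exact h2 hs0
      · exact ⟨k + 1, 0, by omega, by omega, fun _ => h2 (by omega), by omega⟩

theorem AdmissibleDigits.merged_nat (h : AdmissibleDigits a β) (hb : 2 ≤ b) (n : ℕ) :
    ∃ z : ℕ, merged b a β n = z := by
  obtain ⟨k, s, hi, hs, h1, h2⟩ := h.mergePos_spec hb n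
  by_cases hm : MergeAt b a β (mergePos b a β n)
  · have hs0 : s = 0 := by have := hm.1; omega
    obtain ⟨x, hx⟩ := h.cSeq_nat hb (h1 (by omega))
    obtain ⟨y, hy⟩ := h.eSeq_nat hb (k + 1)
    refine ⟨x + 1 + y, ?_⟩
    rw [merged_of_merge hm, show mergePos b a β n / 5 = k by omega, hx, hy]
    push_cast; rfl
  · rw [merged_of_not hm, hi]
    obtain rfl | rfl | rfl | rfl | rfl : s = 0 ∨ s = 1 ∨ s = 2 ∨ s = 3 ∨ s = 4 := by omega
    · rw [add_zero, improper_five_mul]; exact h.cSeq_nat hb (h1 (by omega))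
    · rw [improper_five_mul_add_one]; exact dSeq_nat k hb
    · rw [improper_five_mul_add_two]; exact ⟨1, by simp⟩
    · rw [improper_five_mul_add_three]; exact h.eSeq_nat hb k
    · rw [improper_five_mul_add_four]; exact fSeq_nat hb h.one_le k

/-- The replacement in rule (i) does not change the product of matrices. -/
theorem AdmissibleDigits.listMat_merge (h : AdmissibleDigits a β) (hb : 2 ≤ b) {k : ℕ}
    (hk : β (k + 2) = a (k + 2)) :
    listMat ((List.range' (5 * k) 9).map (improper b a β)) =
      stepMat (cSeq b a β k + 1 + eSeq b a β (k + 1)) := by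
  have h0 := h.rule (k + 1) (by omega) hk
  have hd : dSeq b a β (k + 1) = dSeq b a β k := by rw [dSeq, dSeq, t_succ, h0]; simp
  have hl : (List.range' (5 * k) 9).map (improper b a β) =
      [cSeq b a β k, dSeq b a β k, 1, eSeq b a β k, 0, -(eSeq b a β k + 1), dSeq b a β k, 1,
        eSeq b a β (k + 1)] := by
    have e : (List.range' (5 * k) 9).map (improper b a β) =
        [improper b a β (5 * k), improper b a β (5 * k + 1), improper b a β (5 * k + 2),
          improper b a β (5 * k + 3), improper b a β (5 * k + 4), improper b a β (5 * (k + 1)),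
          improper b a β (5 * (k + 1) + 1), improper b a β (5 * (k + 1) + 2),
          improper b a β (5 * (k + 1) + 3)] := rfl
    simp only [e, improper_five_mul, improper_five_mul_add_one, improper_five_mul_add_two,
      improper_five_mul_add_three, improper_five_mul_add_four, hd, fSeq_eq_zero h0,
      h.cSeq_of_eq hb hk]
  rw [hl]
  simp only [listMat_cons, listMat_nil]
  ext i j
  fin_cases i <;> fin_cases j <;> simp [stepMat, Matrix.mul_apply, Fin.sum_univ_two] <;> ring

theorem AdmissibleDigits.prefixMat_merged (h : AdmissibleDigits a β) (hb : 2 ≤ b) (n : ℕ) :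
    prefixMat (merged b a β) n = prefixMat (improper b a β) (mergePos b a β n) := by
  induction n with
  | zero => rfl
  | succ n ih =>
    rw [prefixMat_succ, ih]
    by_cases hm : MergeAt b a β (mergePos b a β n)
    · rw [mergePos_succ_of_merge hm, merged_of_merge hm, prefixMat_add]
      obtain ⟨k, hk⟩ : ∃ k, mergePos b a β n = 5 * k := ⟨_, (Nat.mul_div_cancel'
        (Nat.dvd_of_mod_eq_zero hm.1)).symm⟩
      rw [hk] at hm ⊢
      rw [h.mergeAt_iff hb] at hm
      rw [h.listMat_merge hb hm, show 5 * k / 5 = k by omega]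
    · rw [mergePos_succ_of_not hm, merged_of_not hm, prefixMat_succ]

theorem mergePos_add_five {n k : ℕ} (hn : mergePos b a β n = 5 * k)
    (hm : ¬ MergeAt b a β (5 * k)) : mergePos b a β (n + 5) = 5 * (k + 1) := by
  have step : ∀ m i, mergePos b a β m = i → ¬ MergeAt b a β i → mergePos b a β (m + 1) = i + 1 := by
    rintro m i rfl h
    exact mergePos_succ_of_not h
  have h1 := step _ _ hn hm
  have h2 := step _ _ h1 (not_mergeAt_of_mod (by omega))
  have h3 := step _ _ h2 (not_mergeAt_of_mod (by omega))
  have h4 := step _ _ h3 (not_mergeAt_of_mod (by omega))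
  exact step (n + 4) (5 * k + 4) h4 (not_mergeAt_of_mod (by omega))

/-- The position of a nonnegative term `c k` is not lost in rule (i). -/
theorem AdmissibleDigits.exists_mergePos_eq (h : AdmissibleDigits a β) (hb : 2 ≤ b) (k : ℕ)
    (hk : β (k + 1) < a (k + 1)) : ∃ n, mergePos b a β n = 5 * k := by
  induction k using Nat.twoStepInduction with
  | zero => exact ⟨0, rfl⟩
  | one =>
    refine ⟨5, mergePos_add_five (n := 0) (k := 0) rfl ?_⟩
    have := h.mergeAt_iff hb 0
    rw [this]
    exact hk.ne
  | more k ih1 ih2 =>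
    rcases (h.le (k + 2) (by omega)).lt_or_eq with hlt | heq
    · obtain ⟨n, hn⟩ := ih2 hlt
      refine ⟨n + 5, mergePos_add_five hn ?_⟩
      rw [h.mergeAt_iff hb]
      exact hk.ne
    · have h0 := h.rule (k + 1) (by omega) heq
      have h1 := h.one_le (k + 1) (by omega)
      obtain ⟨n, hn⟩ := ih1 (by omega)
      have hm : MergeAt b a β (mergePos b a β n) := by rw [hn, h.mergeAt_iff hb]; exact heq
      have e1 := mergePos_succ_of_merge hm
      have e2 := mergePos_succ_of_not (n := n + 1) (not_mergeAt_of_mod (by rw [e1, hn]; omega))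
      exact ⟨n + 1 + 1, by omega⟩

end Merge

/-! ### Existence of a positive contraction -/

section Blocks

variable {b : ℕ} {a β : ℕ → ℕ}

theorem zeroStep_three (x y : ℚ) : Relation.ReflTransGen ZeroStep [x, 0, y] [x + y] :=
  .single (ZeroStep.mk [] [] x y)

theorem zeroStep_five (x y z : ℚ) :
    Relation.ReflTransGen ZeroStep [x, 0, y, 0, z] [x + y + z] :=
  .head (ZeroStep.mk [] [0, z] x y) (zeroStep_three _ _)

/-- The positions of the improper expansion at which a block may start. The conditions ensure that
its first term is positive, except at position `0`, where `d 0 = 0` is absorbed. -/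
def BlockStart (b : ℕ) (a β : ℕ → ℕ) (i : ℕ) : Prop :=
  ∃ k, (i = 5 * k ∧ (MergeAt b a β i ∨ k = 0 ∨ (0 < cSeq b a β k ∧ 0 < t a β k))) ∨
    (i = 5 * k + 1 ∧ 0 < t a β k) ∨ i = 5 * k + 2 ∨ i = 5 * k + 3 ∨
    (i = 5 * k + 4 ∧ 0 < β (k + 1))

/-- The convergent of the improper expansion after `i` terms. -/
def improperConv (b : ℕ) (a β : ℕ → ℕ) (i : ℕ) : ℚ :=
  num (improper b a β) i / den (improper b a β) i

/-- Terms of the merged expansion from a possible start of a block contract to one positive term,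
of one of the listed types. -/
theorem AdmissibleDigits.exists_block (h : AdmissibleDigits a β) (hb : 2 ≤ b) (n : ℕ)
    (hn : BlockStart b a β (mergePos b a β n)) :
    ∃ L, 0 < L ∧ BlockStart b a β (mergePos b a β (n + L)) ∧ ∃ x : ℚ, 0 < x ∧
      Relation.ReflTransGen ZeroStep ((List.range' n L).map (merged b a β)) [x] ∧
      IsTypedConvergent b a β x (improperConv b a β (mergePos b a β (n + L))) := by
  -- reading the merged expansion at a position that is not the start of a merge
  have adv : ∀ m i, mergePos b a β m = i → ¬ MergeAt b a β i →
      mergePos b a β (m + 1) = i + 1 ∧ merged b a β m = improper b a β i := by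
    rintro m i rfl hm
    exact ⟨mergePos_succ_of_not hm, merged_of_not hm⟩
  have nm : ∀ k s, 0 < s → s < 5 → ¬ MergeAt b a β (5 * k + s) := fun k s h1 h2 =>
    not_mergeAt_of_mod (by omega)
  -- reading the merged expansion at a merge
  have mrg : ∀ m k, mergePos b a β m = 5 * k → MergeAt b a β (5 * k) →
      mergePos b a β (m + 1) = 5 * (k + 1) + 4 ∧
        merged b a β m = cSeq b a β k + 1 + eSeq b a β (k + 1) ∧ 0 < β (k + 2) ∧
        0 ≤ cSeq b a β k := by
    intro m k hm hk
    have hm' : MergeAt b a β (mergePos b a β m) := by rwa [hm]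
    have h1 := mergePos_succ_of_merge hm'
    have h2 := merged_of_merge hm'
    rw [hm, show 5 * k / 5 = k by omega] at h2
    rw [h.mergeAt_iff hb] at hk
    have := h.one_le (k + 2) (by omega)
    refine ⟨by omega, h2, by omega, ?_⟩
    have h0 := h.rule (k + 1) (by omega) hk
    have h3 := h.one_le (k + 1) (by omega)
    obtain ⟨z, hz⟩ := h.cSeq_nat hb (k := k) (by omega)
    rw [hz]; positivity
  have cnn : ∀ m k, mergePos b a β m = 5 * k → 0 ≤ cSeq b a β k := by
    intro m k hm
    obtain ⟨k', s, hi, hs, h1, -⟩ := h.mergePos_spec hb m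
    obtain ⟨rfl, rfl⟩ : k = k' ∧ s = 0 := by omega
    obtain ⟨z, hz⟩ := h.cSeq_nat hb (k := k) (h1 (by omega))
    rw [hz]; positivity
  have conv := h.improper_convergents hb
  -- the cases are the starts `c k`, `d k`, `1`, `e k`, `f k`, in this order
  obtain ⟨k, ⟨hi, hc⟩ | ⟨hi, hc⟩ | hi | hi | ⟨hi, hc⟩⟩ := hn
  · by_cases hm : MergeAt b a β (5 * k)
    · obtain ⟨m1, m2, m3, m4⟩ := mrg n k hi hm
      refine ⟨1, one_pos, ?_, cSeq b a β k + 1 + eSeq b a β (k + 1), ?_, ?_, k + 1, ?_⟩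
      · rw [m1]; exact ⟨k + 1, by simp [m3]⟩
      · exact add_pos (add_pos_of_nonneg_of_pos m4 one_pos) (h.eSeq_pos hb (k + 1))
      · simpa [List.range', m2] using Relation.ReflTransGen.refl
      · rw [m1, improperConv, (conv (k + 1)).2.2.2.1]
        have : cSeq b a β k + 1 + eSeq b a β (k + 1) =
          cSeq b a β (k + 1 - 1) + eSeq b a β (k + 1) + 1 := by simp; ring
        simp [this]
    · obtain ⟨m1, v1⟩ := adv _ _ hi hm
      rw [hi] at hc
      rcases hc with hc | rfl | ⟨hc, ht⟩
      · exact absurd hc hm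
      · obtain ⟨m2, v2⟩ := adv _ _ m1 (nm 0 1 (by omega) (by omega))
        obtain ⟨m3, v3⟩ := adv _ _ m2 (nm 0 2 (by omega) (by omega))
        rw [improper_five_mul] at v1
        rw [improper_five_mul_add_one, dSeq_eq_zero (t_zero a β)] at v2
        rw [improper_five_mul_add_two] at v3
        refine ⟨3, by omega, ?_, cSeq b a β 0 + 1, ?_, ?_, 0, ?_⟩
        · rw [m3]; exact ⟨0, by simp⟩
        · exact add_pos_of_nonneg_of_pos (cnn _ _ hi) one_pos
        · simpa [List.range', v1, v2, v3] using zeroStep_three (cSeq b a β 0) 1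
        · rw [m3, improperConv, (conv 0).2.2.1]; simp
      · refine ⟨1, one_pos, ?_, _, hc, ?_, k, ?_⟩
        · rw [m1]; exact ⟨k, by simp [ht]⟩
        · simpa [List.range', v1, improper_five_mul] using Relation.ReflTransGen.refl
        · rw [m1, improperConv, (conv k).1]; simp
  · obtain ⟨m1, v1⟩ := adv _ _ hi (nm k 1 (by omega) (by omega))
    refine ⟨1, one_pos, ?_, _, dSeq_pos hb hc, ?_, k, ?_⟩
    · rw [m1]; exact ⟨k, by simp⟩
    · simpa [List.range', v1, improper_five_mul_add_one] using Relation.ReflTransGen.refl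
    · rw [m1, improperConv, (conv k).2.1]; simp
  · obtain ⟨m1, v1⟩ := adv _ _ hi (nm k 2 (by omega) (by omega))
    refine ⟨1, one_pos, ?_, 1, one_pos, ?_, k, ?_⟩
    · rw [m1]; exact ⟨k, by simp⟩
    · simpa [List.range', v1, improper_five_mul_add_two] using Relation.ReflTransGen.refl
    · rw [m1, improperConv, (conv k).2.2.1]; simp
  · obtain ⟨m1, v1⟩ := adv _ _ hi (nm k 3 (by omega) (by omega))
    have he := h.eSeq_pos hb k
    rw [improper_five_mul_add_three] at v1
    rcases Nat.eq_zero_or_pos (β (k + 1)) with hβ | hβ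
    · obtain ⟨m2, v2⟩ := adv _ _ m1 (nm k 4 (by omega) (by omega))
      rw [improper_five_mul_add_four, fSeq_eq_zero hβ] at v2
      change _ = 5 * (k + 1) at m2
      by_cases hm : MergeAt b a β (5 * (k + 1))
      · obtain ⟨m3, v3, m5, m6⟩ := mrg _ _ m2 hm
        refine ⟨3, by omega, ?_, eSeq b a β k + (cSeq b a β (k + 1) + 1 + eSeq b a β (k + 2)),
          ?_, ?_, k + 2, ?_⟩
        · rw [m3]; exact ⟨k + 2, by simp [m5]⟩
        · have := h.eSeq_pos hb (k + 2); linarith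
        · simpa [List.range', v1, v2, v3] using zeroStep_three _ _
        · rw [m3, improperConv, (conv (k + 2)).2.2.2.1]
          have : eSeq b a β k + (cSeq b a β (k + 1) + 1 + eSeq b a β (k + 2)) =
            eSeq b a β (k + 2 - 2) + cSeq b a β (k + 2 - 1) + eSeq b a β (k + 2) + 1 := by
              simp; ring
          simp [this]
      · obtain ⟨m3, v3⟩ := adv _ _ m2 hm
        have hc := cnn _ _ m2
        rw [improper_five_mul] at v3
        rcases Nat.eq_zero_or_pos (t a β (k + 1)) with ht | ht
        · obtain ⟨m4, v4⟩ := adv _ _ m3 (nm (k + 1) 1 (by omega) (by omega))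
          obtain ⟨m5, v5⟩ := adv _ _ m4 (nm (k + 1) 2 (by omega) (by omega))
          rw [improper_five_mul_add_one, dSeq_eq_zero ht] at v4
          rw [improper_five_mul_add_two] at v5
          refine ⟨5, by omega, ?_, eSeq b a β k + cSeq b a β (k + 1) + 1, ?_, ?_, k + 1, ?_⟩
          · rw [m5]; exact ⟨k + 1, by simp⟩
          · linarith
          · simpa [List.range', v1, v2, v3, v4, v5] using zeroStep_five _ _ _
          · rw [m5, improperConv, (conv (k + 1)).2.2.1]; simp
        · refine ⟨3, by omega, ?_, eSeq b a β k + cSeq b a β (k + 1), ?_, ?_, k + 1, ?_⟩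
          · rw [m3]; exact ⟨k + 1, by simp [ht]⟩
          · linarith
          · simpa [List.range', v1, v2, v3] using zeroStep_three _ _
          · rw [m3, improperConv, (conv (k + 1)).1]; simp
    · refine ⟨1, one_pos, ?_, _, he, ?_, k, ?_⟩
      · rw [m1]; exact ⟨k, by simp [hβ]⟩
      · simpa [List.range', v1] using Relation.ReflTransGen.refl
      · rw [m1, improperConv, (conv k).2.2.2.1]; simp
  · obtain ⟨m1, v1⟩ := adv _ _ hi (nm k 4 (by omega) (by omega))
    have hf := fSeq_pos hb h.one_le hc
    rw [improper_five_mul_add_four] at v1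
    change _ = 5 * (k + 1) at m1
    have ht : 0 < t a β (k + 1) := by
      rw [t_succ]
      have := Nat.mul_pos hc (q_pos h.one_le k)
      omega
    have single : BlockStart b a β (5 * (k + 1)) → ∃ L, 0 < L ∧
        BlockStart b a β (mergePos b a β (n + L)) ∧ ∃ x : ℚ, 0 < x ∧
        Relation.ReflTransGen ZeroStep ((List.range' n L).map (merged b a β)) [x] ∧
        IsTypedConvergent b a β x (improperConv b a β (mergePos b a β (n + L))) := by
      intro hs
      refine ⟨1, one_pos, ?_, _, hf, ?_, k, ?_⟩
      · rwa [m1]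
      · simpa [List.range', v1] using Relation.ReflTransGen.refl
      · rw [m1, improperConv, show 5 * (k + 1) = 5 * k + 5 by ring, (conv k).2.2.2.2]; simp
    by_cases hm : MergeAt b a β (5 * (k + 1))
    · exact single ⟨k + 1, by simp [hm]⟩
    · rcases (cnn _ _ m1).lt_or_eq with hc0 | hc0
      · exact single ⟨k + 1, by simp [hc0, ht]⟩
      · obtain ⟨m2, v2⟩ := adv _ _ m1 hm
        obtain ⟨m3, v3⟩ := adv _ _ m2 (nm (k + 1) 1 (by omega) (by omega))
        rw [improper_five_mul, ← hc0] at v2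
        rw [improper_five_mul_add_one] at v3
        refine ⟨3, by omega, ?_, fSeq b a β k + dSeq b a β (k + 1), ?_, ?_, k + 1, ?_⟩
        · rw [m3]; exact ⟨k + 1, by simp⟩
        · exact add_pos hf (dSeq_pos hb ht)
        · simpa [List.range', v1, v2, v3] using zeroStep_three _ _
        · rw [m3, improperConv, (conv (k + 1)).2.1]; simp

theorem AdmissibleDigits.exists_contraction (h : AdmissibleDigits a β) (hb : 2 ≤ b) :
    ∃ A : ℕ → ℚ, (∀ n, 0 < A n) ∧ IsContraction (merged b a β) A ∧
      ∀ n, IsTypedConvergent b a β (A n) (num A (n + 1) / den A (n + 1)) := by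
  choose! L hL hstart x hx hstep htype using h.exists_block hb
  let s : ℕ → ℕ := fun n => Nat.rec 0 (fun _ m => m + L m) n
  have hs : ∀ n, BlockStart b a β (mergePos b a β (s n)) := by
    intro n
    induction n with
    | zero => exact ⟨0, by simp [s, mergePos]⟩
    | succ n ih => exact hstart _ ih
  have hsucc : ∀ n, s (n + 1) = s n + L (s n) := fun n => rfl
  have hmono : StrictMono s := strictMono_nat_of_lt_succ fun n => by
    have := hL _ (hs n)
    rw [hsucc]; omega
  have hblock : ∀ n, Relation.ReflTransGen ZeroStep
      ((List.range' (s n) (s (n + 1) - s n)).map (merged b a β)) [x (s n)] := by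
    intro n
    rw [hsucc, Nat.add_sub_cancel_left]
    exact hstep _ (hs n)
  refine ⟨fun n => x (s n), fun n => hx _ (hs n), ⟨s, rfl, hmono, hblock⟩, fun n => ?_⟩
  have := prefixMat_contraction (A := fun n => x (s n)) rfl hmono hblock (n + 1)
  rw [h.prefixMat_merged hb] at this
  rw [num, den, this]
  exact htype _ (hs n)

end Blocks

/-! ### The words `M k` as Sturmian words of rational slope -/

section Slope

/-- The parity of `k`, as an integer. -/
def parity (k : ℕ) : ℤ := ((k % 2 : ℕ) : ℤ)

theorem parity_succ (k : ℕ) : parity (k + 1) = 1 - parity k := by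
  unfold parity; omega

theorem parity_cases (k : ℕ) : parity k = 0 ∨ parity k = 1 := by
  unfold parity; omega

theorem p_add_two (a : ℕ → ℕ) (k : ℕ) : p a (k + 2) = a (k + 2) * p a (k + 1) + p a k := rfl

theorem q_add_two (a : ℕ → ℕ) (k : ℕ) : q a (k + 2) = a (k + 2) * q a (k + 1) + q a k := rfl

theorem det_p_q (a : ℕ → ℕ) (k : ℕ) :
    (p a (k + 1) : ℤ) * q a k - p a k * q a (k + 1) = 1 - 2 * parity k := by
  induction k with
  | zero => simp [p, q, parity]
  | succ k ih =>
    rw [parity_succ, p_add_two, q_add_two]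
    push_cast
    linear_combination -ih

/-- The number of letters `1` among the first `z - 1` letters of the periodic word with period `M k`
(for `z ≥ 1`). It is `⌊z * p k / q k⌋` for even `k` and `⌈z * p k / q k⌉ - 1` for odd `k`. -/
def count (a : ℕ → ℕ) (k : ℕ) (z : ℤ) : ℤ := (z * p a k - parity k) / q a k

variable {a : ℕ → ℕ}

theorem count_eq_iff (ha : ∀ k, 1 ≤ k → 1 ≤ a k) {k : ℕ} {z y : ℤ} :
    count a k z = y ↔ y * q a k ≤ z * p a k - parity k ∧
      z * p a k - parity k < (y + 1) * q a k := by
  have hq : (0 : ℤ) < q a k := by exact_mod_cast q_pos ha k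
  rw [count, ← Int.le_ediv_iff_mul_le hq, ← Int.ediv_lt_iff_lt_mul hq]
  omega

theorem count_add_q (ha : ∀ k, 1 ≤ k → 1 ≤ a k) (k : ℕ) (z : ℤ) :
    count a k (z + q a k) = count a k z + p a k := by
  obtain ⟨h1, h2⟩ := (count_eq_iff ha).1 (rfl : count a k z = _)
  rw [count_eq_iff ha]
  constructor <;> nlinarith

/-- Inside the first copies of `M k` at the beginning of `M (k + 1)`. -/
theorem count_succ_of_lt (ha : ∀ k, 1 ≤ k → 1 ≤ a k) {k : ℕ} (hk : 1 ≤ k) {i n : ℤ}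
    (hi0 : 0 ≤ i) (hi : i < a (k + 1)) (hn1 : 1 ≤ n) (hn : n ≤ q a k + 1) :
    count a (k + 1) (i * q a k + n) = i * p a k + count a k n := by
  obtain ⟨h1, h2⟩ := (count_eq_iff ha).1 (rfl : count a k n = _)
  rw [count_eq_iff ha, parity_succ]
  have hdet := det_p_q a k
  have hQ : (q a (k + 1) : ℤ) = a (k + 1) * q a k + qPrev a k := by exact_mod_cast q_succ a k
  have hq : (1 : ℤ) ≤ q a k := by exact_mod_cast q_pos ha k
  have hq' : (1 : ℤ) ≤ qPrev a k := by
    obtain ⟨k, rfl⟩ := Nat.exists_eq_add_of_le' hk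
    exact_mod_cast q_pos ha k
  have hQ1 : (1 : ℤ) ≤ q a (k + 1) := by exact_mod_cast q_pos ha (k + 1)
  generalize count a k n = y at *
  generalize (p a (k + 1) : ℤ) = P at *
  generalize (q a (k + 1) : ℤ) = Q at *
  generalize (p a k : ℤ) = p at *
  generalize (q a k : ℤ) = q at *
  generalize (qPrev a k : ℤ) = q' at *
  generalize (a (k + 1) : ℤ) = A at *
  have e1 : (i * q + n) * P - (i * p + y) * Q = i * (P * q - p * Q) + (n * P - y * Q) := by ring
  have e2 : (i * q + n) * P - (i * p + y + 1) * Q =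
    i * (P * q - p * Q) + (n * P - (y + 1) * Q) := by ring
  have e3 : q * (n * P - y * Q) = n * (P * q - p * Q) + Q * (n * p - y * q) := by ring
  have e4 : q * (n * P - (y + 1) * Q) = n * (P * q - p * Q) + Q * (n * p - (y + 1) * q) := by ring
  rw [hdet] at e1 e2 e3 e4
  have hiq : i * q ≤ (A - 1) * q := by nlinarith
  rcases parity_cases k with h0 | h0 <;> rw [h0] at h1 h2 e1 e2 e3 e4 ⊢
  · have l : 1 ≤ n * P - y * Q := by
      by_contra! hlt
      nlinarith [mul_nonneg (by linarith : 0 ≤ Q) (by linarith : 0 ≤ n * p - y * q)]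
    have u : n * P - (y + 1) * Q ≤ -i := by
      by_contra! hlt
      nlinarith [mul_nonneg (by linarith : 0 ≤ Q) (by linarith : 0 ≤ -(n * p - (y + 1) * q) - 1)]
    constructor <;> linarith
  · have l : i ≤ n * P - y * Q := by
      by_contra! hlt
      nlinarith [mul_nonneg (by linarith : 0 ≤ Q) (by linarith : 0 ≤ n * p - y * q - 1)]
    have u : n * P - (y + 1) * Q ≤ -1 := by
      by_contra! hlt
      nlinarith [mul_nonneg (by linarith : 0 ≤ Q) (by linarith : 0 ≤ -(n * p - (y + 1) * q))]
    constructor <;> linarith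

/-- Inside the last factor `M k` of `M (k + 2)`. -/
theorem count_add_two_last (ha : ∀ k, 1 ≤ k → 1 ≤ a k) {k : ℕ} {n : ℤ}
    (hn1 : 1 ≤ n) (hn : n ≤ q a k + 1) :
    count a (k + 2) (a (k + 2) * q a (k + 1) + n) = a (k + 2) * p a (k + 1) + count a k n := by
  obtain ⟨h1, h2⟩ := (count_eq_iff ha).1 (rfl : count a k n = _)
  rw [count_eq_iff ha, parity_succ, parity_succ, p_add_two, q_add_two]
  have hdet := det_p_q a k
  have hq : (1 : ℤ) ≤ q a (k + 1) := by exact_mod_cast q_pos ha (k + 1)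
  have hq' : (1 : ℤ) ≤ q a k := by exact_mod_cast q_pos ha k
  have hA : (1 : ℤ) ≤ a (k + 2) := by exact_mod_cast ha (k + 2) (by omega)
  push_cast
  generalize count a k n = y at *
  generalize (p a (k + 1) : ℤ) = p at *
  generalize (q a (k + 1) : ℤ) = q at *
  generalize (SturmianCF.p a k : ℤ) = p' at *
  generalize (SturmianCF.q a k : ℤ) = q' at *
  generalize (a (k + 2) : ℤ) = A at *
  have e1 : (A * q + n) * (A * p + p') - (A * p + y) * (A * q + q') =
      -A * (p * q' - p' * q) + A * (n * p - y * q) + (n * p' - y * q') := by ring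
  have e2 : (A * q + n) * (A * p + p') - (A * p + y + 1) * (A * q + q') =
      -A * (p * q' - p' * q) + A * (n * p - (y + 1) * q) + (n * p' - (y + 1) * q') := by ring
  have e3 : q' * (n * p - y * q) = n * (p * q' - p' * q) + q * (n * p' - y * q') := by ring
  have e4 : q' * (n * p - (y + 1) * q) =
      n * (p * q' - p' * q) + q * (n * p' - (y + 1) * q') := by ring
  rw [hdet] at e1 e2 e3 e4
  rcases parity_cases k with h0 | h0 <;> rw [h0] at h1 h2 e1 e2 e3 e4 ⊢
  · have l : 1 ≤ n * p - y * q := by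
      by_contra! hlt
      nlinarith [mul_nonneg (by linarith : 0 ≤ q) (by linarith : 0 ≤ n * p' - y * q')]
    have u : n * p - (y + 1) * q ≤ 1 := by
      by_contra! hlt
      nlinarith [mul_nonneg (by linarith : 0 ≤ q)
        (by linarith : 0 ≤ -(n * p' - (y + 1) * q') - 1)]
    constructor <;> nlinarith
  · have l : -1 ≤ n * p - y * q := by
      by_contra! hlt
      nlinarith [mul_nonneg (by linarith : 0 ≤ q) (by linarith : 0 ≤ n * p' - y * q' - 1)]
    have u : n * p - (y + 1) * q ≤ -1 := by
      by_contra! hlt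
      nlinarith [mul_nonneg (by linarith : 0 ≤ q) (by linarith : 0 ≤ -(n * p' - (y + 1) * q'))]
    constructor <;> nlinarith

theorem p_le_q (ha : ∀ k, 1 ≤ k → 1 ≤ a k) (k : ℕ) : p a k ≤ q a k := by
  induction k using Nat.twoStepInduction with
  | zero => simp [p]
  | one => simpa [p, q] using ha 1 le_rfl
  | more k ih1 ih2 =>
    rw [p_add_two, q_add_two]
    exact add_le_add (Nat.mul_le_mul_left _ ih2) ih1

/-- The letter with index `z` (from `0`) of the periodic word with period `M k`. -/
def periodicLetter (a : ℕ → ℕ) (k : ℕ) (z : ℤ) : ℤ := count a k (z + 2) - count a k (z + 1)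

theorem periodicLetter_nonneg (ha : ∀ k, 1 ≤ k → 1 ≤ a k) (k : ℕ) (z : ℤ) :
    0 ≤ periodicLetter a k z := by
  rw [periodicLetter, sub_nonneg]
  have hq : (0 : ℤ) < q a k := by exact_mod_cast q_pos ha k
  refine Int.ediv_le_ediv hq ?_
  have : (0 : ℤ) ≤ p a k := Nat.cast_nonneg _
  linarith

theorem periodicLetter_le_one (ha : ∀ k, 1 ≤ k → 1 ≤ a k) (k : ℕ) (z : ℤ) :
    periodicLetter a k z ≤ 1 := by
  have hp : (p a k : ℤ) ≤ q a k := by exact_mod_cast p_le_q ha k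
  obtain ⟨-, h2⟩ := (count_eq_iff ha).1 (rfl : count a k (z + 1) = _)
  obtain ⟨h3, -⟩ := (count_eq_iff ha).1 (rfl : count a k (z + 2) = _)
  have hq : (0 : ℤ) < q a k := by exact_mod_cast q_pos ha k
  rw [periodicLetter]
  by_contra! h
  nlinarith

theorem periodicLetter_add_q (ha : ∀ k, 1 ≤ k → 1 ≤ a k) (k : ℕ) (z : ℤ) :
    periodicLetter a k (z + q a k) = periodicLetter a k z := by
  rw [periodicLetter, periodicLetter, add_right_comm, count_add_q ha, add_right_comm z _ 1,
    count_add_q ha]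
  ring

theorem map_range_mul {f g : ℕ → ℕ} {n Q : ℕ}
    (h : ∀ i < n, ∀ j < Q, f (i * Q + j) = g j) :
    (List.range (n * Q)).map f = repeatWord n ((List.range Q).map g) := by
  induction n with
  | zero => simp [repeatWord_zero]
  | succ n ih =>
    rw [repeatWord_add, ← ih fun i hi => h i (by omega), add_mul, one_mul, List.range_add,
      List.map_append, List.map_map]
    congr 1
    rw [repeatWord_succ, repeatWord_zero, List.append_nil]
    exact List.map_congr_left fun j hj => h n (by omega) j (List.mem_range.1 hj)

/-- The words `M k` are the periods of the Sturmian words of slope `p k / q k`. -/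
theorem M_eq_map (ha : ∀ k, 1 ≤ k → 1 ≤ a k) (k : ℕ) :
    M a k = (List.range (q a k)).map fun j : ℕ => (periodicLetter a k (j : ℤ)).toNat := by
  induction k using Nat.twoStepInduction with
  | zero => simp [M, q, periodicLetter, count, p, parity]
  | one =>
    obtain ⟨n, hn⟩ := Nat.exists_eq_add_of_le' (ha 1 le_rfl)
    have hl : ∀ j : ℕ, j ≤ n → periodicLetter a 1 j = if j = n then 1 else 0 := by
      intro j hj
      have h1 : count a 1 (j + 1) = 0 := by
        rw [count_eq_iff ha]; simp [p, q, parity, hn]; omega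
      have h2 : count a 1 (j + 2) = if j = n then 1 else 0 := by
        rw [count_eq_iff ha]; split_ifs <;> simp [p, q, parity, hn] <;> omega
      rw [periodicLetter, h1, h2, sub_zero]
    simp only [M, q, hn, Nat.add_sub_cancel, List.range_succ, List.map_append, List.map_singleton]
    rw [hl n le_rfl, List.map_congr_left (g := fun _ => 0)]
    · simp
    · intro j hj
      have := List.mem_range.1 hj
      rw [hl j this.le, if_neg this.ne]; rfl
  | more k ih1 ih2 =>
    have hpos := q_pos ha (k + 1)
    have hpos' := q_pos ha k
    rw [M_add_two, ih1, ih2, q_add_two, List.range_add, List.map_append, List.map_map]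
    congr 1
    · refine (map_range_mul fun i hi j hj => ?_).symm
      have e1 := count_succ_of_lt ha (k := k + 1) (by omega) (i := i) (n := (j : ℤ) + 1)
        (by omega) (by exact_mod_cast hi) (by omega) (by omega)
      have e2 := count_succ_of_lt ha (k := k + 1) (by omega) (i := i) (n := (j : ℤ) + 2)
        (by omega) (by exact_mod_cast hi) (by omega) (by omega)
      congr 1
      rw [periodicLetter, periodicLetter]
      push_cast
      rw [add_assoc, add_assoc, e1, e2]
      ring
    · refine List.map_congr_left fun j hj => ?_
      have hj := List.mem_range.1 hj
      have e1 := count_add_two_last ha (k := k) (n := (j : ℤ) + 1) (by omega) (by omega)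
      have e2 := count_add_two_last ha (k := k) (n := (j : ℤ) + 2) (by omega) (by omega)
      simp only [Function.comp_apply]
      congr 1
      rw [periodicLetter, periodicLetter]
      push_cast
      rw [add_assoc, add_assoc, e1, e2]
      ring

variable {β : ℕ → ℕ}

/-- `V k` is the conjugate of `M k` by `t k` letters. -/
theorem AdmissibleDigits.V_eq_map (h : AdmissibleDigits a β) (k : ℕ) :
    R a β k ++ T a β k =
      (List.range (q a k)).map fun j : ℕ =>
        (periodicLetter a k ((j + t a β k : ℕ) : ℤ)).toNat := by
  obtain ⟨n, hn⟩ := Nat.exists_eq_add_of_le (h.t_lt k).le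
  have hM := M_eq_map h.one_le k
  rw [hn, List.range_add, List.map_append, List.map_map] at hM
  rw [R, T, hM, hn.trans (add_comm _ _), List.range_add, List.map_append, List.map_map,
    List.drop_append_of_le_length (by simp), List.take_append_of_le_length (by simp)]
  rw [List.drop_of_length_le (by simp), List.take_of_length_le (by simp), List.nil_append]
  congr 1
  · refine List.map_congr_left fun j _ => ?_
    simp only [Function.comp_apply, add_comm]
  · refine List.map_congr_left fun j _ => ?_
    simp only [Function.comp_apply]
    rw [← periodicLetter_add_q h.one_le k j, hn]
    congr 2
    push_cast
    ring

end Slope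

/-! ### Periodic expansions and their convergence -/

section Series

theorem val_map_range (b : ℕ) (hb : 2 ≤ b) (f : ℕ → ℕ) (n : ℕ) :
    ((val b ((List.range n).map f) : ℚ) : ℝ) =
      ((b : ℝ) - 1) * ((b : ℝ) ^ n * ∑ i ∈ Finset.range n, (f i : ℝ) / (b : ℝ) ^ (i + 1)) := by
  have hb0 : (b : ℝ) ≠ 0 := by positivity
  induction n with
  | zero => simp [val_nil]
  | succ n ih =>
    rw [List.range_succ, List.map_append, val_append, Finset.sum_range_succ]
    push_cast
    rw [ih]
    simp only [List.map_singleton, val_singleton, List.length_singleton]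
    push_cast [Nat.cast_sub (show 1 ≤ b by omega)]
    field_simp
    ring

theorem summable_one_div_pow_succ (b : ℕ) (hb : 2 ≤ b) :
    Summable fun n : ℕ => 1 / (b : ℝ) ^ (n + 1) := by
  have h1 : (1 : ℝ) < b := by exact_mod_cast hb
  have := (summable_geometric_of_lt_one (r := (b : ℝ)⁻¹) (by positivity)
    (inv_lt_one_of_one_lt₀ h1)).mul_left (b : ℝ)⁻¹
  refine this.congr fun n => ?_
  rw [pow_succ, one_div, mul_inv, inv_pow, mul_comm]

theorem summable_div_pow (b : ℕ) (hb : 2 ≤ b) {w : ℕ → ℝ} (h0 : ∀ n, 0 ≤ w n) (h1 : ∀ n, w n ≤ 1) :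
    Summable fun n : ℕ => w n / (b : ℝ) ^ (n + 1) := by
  refine Summable.of_nonneg_of_le (fun n => ?_) (fun n => ?_) (summable_one_div_pow_succ b hb)
  · have := h0 n; positivity
  · have := h1 n; gcongr

theorem periodic_series (b : ℕ) (hb : 2 ≤ b) {w : ℕ → ℝ} (h0 : ∀ n, 0 ≤ w n) (h1 : ∀ n, w n ≤ 1)
    {N : ℕ} (hw : ∀ n, w (n + N) = w n) :
    (b : ℝ) ^ N * ∑ i ∈ Finset.range N, w i / (b : ℝ) ^ (i + 1) =
      ((b : ℝ) ^ N - 1) * ∑' n, w n / (b : ℝ) ^ (n + 1) := by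
  have hb0 : (b : ℝ) ≠ 0 := by positivity
  have hs := summable_div_pow b hb h0 h1
  have h := hs.sum_add_tsum_nat_add N
  have e : ∑' n, w (n + N) / (b : ℝ) ^ (n + N + 1) =
      ((b : ℝ) ^ N)⁻¹ * ∑' n, w n / (b : ℝ) ^ (n + 1) := by
    rw [← tsum_mul_left]
    refine tsum_congr fun n => ?_
    rw [hw, show n + N + 1 = N + (n + 1) by ring, pow_add]
    field_simp
  rw [e] at h
  field_simp at h
  linear_combination h

variable {b : ℕ} {a β : ℕ → ℕ}

/-- The fractions `(4)` are the numbers with periodic expansions. -/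
theorem AdmissibleDigits.val_V_div (h : AdmissibleDigits a β) (hb : 2 ≤ b) (k : ℕ) :
    ((val b (R a β k ++ T a β k) / ((b : ℚ) ^ q a k - 1) : ℚ) : ℝ) =
      ((b : ℝ) - 1) * ∑' n : ℕ,
        (periodicLetter a k (n + t a β k : ℕ) : ℝ) / (b : ℝ) ^ (n + 1) := by
  have hnn := periodicLetter_nonneg h.one_le k
  have hcast : ∀ n : ℕ, (((periodicLetter a k (n + t a β k : ℕ)).toNat : ℕ) : ℝ) =
      (periodicLetter a k (n + t a β k : ℕ) : ℝ) := by
    intro n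
    exact_mod_cast congrArg (Int.cast (R := ℝ)) (Int.toNat_of_nonneg (hnn (n + t a β k : ℕ)))
  have hq : ((b : ℝ) ^ q a k - 1) ≠ 0 := by
    have := pow_q_ne_one hb h.one_le k
    exact_mod_cast this
  rw [Rat.cast_div, Rat.cast_sub, Rat.cast_pow, Rat.cast_natCast, Rat.cast_one, h.V_eq_map,
    val_map_range b hb, div_eq_iff hq]
  simp only [hcast]
  have hper := periodic_series b hb (N := q a k)
    (w := fun n : ℕ => (periodicLetter a k (n + t a β k : ℕ) : ℝ))
    (fun n => by exact_mod_cast hnn _)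
    (fun n => by exact_mod_cast periodicLetter_le_one h.one_le k _)
    (fun n => by
      rw [← periodicLetter_add_q h.one_le k (n + t a β k : ℕ)]
      push_cast
      congr 2
      ring)
  rw [hper]
  ring

/-- Convergence of the letters of the periodic words implies that of the fractions `(4)`. -/
theorem AdmissibleDigits.tendsto_val_V (h : AdmissibleDigits a β) (hb : 2 ≤ b) {ε : Rounding}
    {θ ρ : ℝ} {l : Filter ℕ}
    (hl : ∀ n : ℕ, ∀ᶠ k in l, periodicLetter a k (n + t a β k : ℕ) = letter ε θ ρ (n + 1)) :
    Tendsto (fun k => ((val b (R a β k ++ T a β k) / ((b : ℚ) ^ q a k - 1) : ℚ) : ℝ)) l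
      (𝓝 (sturmianNumber b ε θ ρ)) := by
  simp only [h.val_V_div hb]
  refine Tendsto.const_mul _ ?_
  refine tendsto_tsum_of_dominated_convergence (summable_one_div_pow_succ b hb) (fun n => ?_)
    (Eventually.of_forall fun k n => ?_)
  · refine tendsto_const_nhds.congr' ?_
    filter_upwards [hl n] with k hk
    rw [hk]
  · have h0 : (0 : ℝ) ≤ periodicLetter a k (n + t a β k : ℕ) := by
      exact_mod_cast periodicLetter_nonneg h.one_le k _
    have h1 : (periodicLetter a k (n + t a β k : ℕ) : ℝ) ≤ 1 := by
      exact_mod_cast periodicLetter_le_one h.one_le k _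
    rw [Real.norm_of_nonneg (by positivity)]
    gcongr

/-- The number `ξ` is a limit point of the convergents of the merged expansion. -/
theorem AdmissibleDigits.merged_limit_point (h : AdmissibleDigits a β) (hb : 2 ≤ b) {ε : Rounding}
    {θ ρ : ℝ} {S : Set ℕ} (hS : S.Infinite) (hSβ : ∀ k ∈ S, β (k + 1) < a (k + 1))
    (hl : ∀ n : ℕ, ∀ᶠ k in atTop, k ∈ S →
      periodicLetter a k (n + t a β k : ℕ) = letter ε θ ρ (n + 1))
    (N : ℕ) (η : ℝ) (hη : 0 < η) :
    ∃ j, N ≤ j ∧ 0 < den (merged b a β) j ∧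
      |((num (merged b a β) j / den (merged b a β) j : ℚ) : ℝ) - sturmianNumber b ε θ ρ| < η := by
  have ht := h.tendsto_val_V hb (l := atTop ⊓ 𝓟 S) (ε := ε) (θ := θ) (ρ := ρ)
    fun n => eventually_inf_principal.2 (hl n)
  have hev := eventually_inf_principal.1 ((Metric.tendsto_nhds.1 ht) η hη)
  obtain ⟨K, hK⟩ := eventually_atTop.1 hev
  obtain ⟨k, hkS, hk⟩ := hS.exists_gt (max K (2 * N))
  have hkη := hK k ((le_max_left _ _).trans hk.le) hkS
  have hkN : 2 * N < k := (le_max_right _ _).trans_lt hk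
  obtain ⟨n, hn⟩ := h.exists_mergePos_eq hb k (hSβ k hkS)
  have hmat := h.prefixMat_improper hb k
  rw [← hn, ← h.prefixMat_merged hb] at hmat
  have hle : ∀ n, mergePos b a β n ≤ 9 * n := by
    intro n
    induction n with
    | zero => simp [mergePos]
    | succ n ih => rw [mergePos]; split_ifs <;> omega
  refine ⟨n, by have := hle n; omega, ?_, ?_⟩
  · have hden : ((b : ℚ) - 1) * den (merged b a β) n = (b : ℚ) ^ q a k - 1 :=
      congrFun (congrFun hmat 0) 0
    have h1 := one_lt_pow_q hb h.one_le k
    have h2 : (2 : ℚ) ≤ b := by exact_mod_cast hb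
    by_contra! h3
    nlinarith
  · rw [num_div_den_of_smul hb hmat, ← Real.dist_eq]
    exact hkη

end Series

/-! ### Approximation of the slope and of the intercept -/

section Approximation

variable {a : ℕ → ℕ} {θ : ℝ}

theorem HasRegCF.one_le_nat (ha : HasRegCF θ fun n => (a (n + 1) : ℚ)) (k : ℕ) (hk : 1 ≤ k) :
    1 ≤ a k := by
  obtain ⟨k, rfl⟩ := Nat.exists_eq_add_of_le' hk
  exact_mod_cast ha.one_le k

theorem den_eq_q (a : ℕ → ℕ) (k : ℕ) : den (fun n => (a (n + 1) : ℚ)) k = q a k := by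
  induction k using Nat.twoStepInduction with
  | zero => simp [den_zero, q]
  | one => simp [den_one, q]
  | more k ih1 ih2 => rw [den_add_two, ih1, ih2, q_add_two]; push_cast; rfl

theorem num_eq_p (a : ℕ → ℕ) (k : ℕ) : num (fun n => (a (n + 1) : ℚ)) k = p a k := by
  induction k using Nat.twoStepInduction with
  | zero => simp [num_zero, p]
  | one => simp [num_one, p]
  | more k ih1 ih2 => rw [num_add_two, ih1, ih2, p_add_two]; push_cast; rfl

theorem HasRegCF.abs_sub_le (ha : HasRegCF θ fun n => (a (n + 1) : ℚ)) (k : ℕ) :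
    |θ - p a k / q a k| ≤ 1 / ((q a k : ℝ) * q a (k + 1)) := by
  have hnt : ¬ (GenContFract.of θ).TerminatedAt k := by
    rw [GenContFract.terminatedAt_iff_s_none, ha.get k]
    simp
  have h := GenContFract.abs_sub_convs_le hnt
  rw [ha.convs, (ha.nums_dens k).2, (ha.nums_dens (k + 1)).2, den_eq_q, num_eq_p, den_eq_q] at h
  push_cast at h
  exact h

theorem le_q (ha : ∀ k, 1 ≤ k → 1 ≤ a k) (k : ℕ) : k ≤ q a k := by
  induction k using Nat.twoStepInduction with
  | zero => simp
  | one => exact q_pos ha 1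
  | more k ih1 ih2 =>
    have h1 := q_pos ha k
    have h2 := Nat.mul_le_mul_right (q a (k + 1)) (ha (k + 2) (by omega))
    rw [q_add_two]
    omega

theorem tendsto_one_div_q (ha : ∀ k, 1 ≤ k → 1 ≤ a k) :
    Tendsto (fun k => 1 / (q a k : ℝ)) atTop (𝓝 0) := by
  simp only [one_div]
  exact tendsto_inv_atTop_zero.comp (tendsto_natCast_atTop_atTop.comp
    (tendsto_atTop_mono (le_q ha) tendsto_id))

theorem HasRegCF.tendsto_mul_sub (ha : HasRegCF θ fun n => (a (n + 1) : ℚ)) {s : ℕ → ℕ}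
    (hs : ∀ k, s k ≤ q a k) :
    Tendsto (fun k => (s k : ℝ) * (p a k / q a k - θ)) atTop (𝓝 0) := by
  have hq := (tendsto_add_atTop_iff_nat 1).2 (tendsto_one_div_q ha.one_le_nat)
  refine squeeze_zero_norm (fun k => ?_) hq
  have h1 := ha.abs_sub_le k
  have h2 : (s k : ℝ) ≤ q a k := by exact_mod_cast hs k
  have h3 : (0 : ℝ) < q a k := by exact_mod_cast q_pos ha.one_le_nat k
  have h4 : (0 : ℝ) < q a (k + 1) := by exact_mod_cast q_pos ha.one_le_nat (k + 1)
  rw [Real.norm_eq_abs, abs_mul, abs_of_nonneg (Nat.cast_nonneg _), abs_sub_comm]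
  calc (s k : ℝ) * |θ - p a k / q a k| ≤ q a k * (1 / ((q a k : ℝ) * q a (k + 1))) := by gcongr
    _ = 1 / (q a (k + 1) : ℝ) := by field_simp

theorem HasRegCF.tendsto_p_div_q (ha : HasRegCF θ fun n => (a (n + 1) : ℚ)) :
    Tendsto (fun k => (p a k / q a k : ℝ)) atTop (𝓝 θ) := by
  have := (ha.tendsto_mul_sub (s := fun _ => 1) fun k => q_pos ha.one_le_nat k).add_const θ
  simpa using this

/-- At a limit that is not an integer, the counting function converges to the integer part. -/
theorem eventually_count_eq (ha : ∀ k, 1 ≤ k → 1 ≤ a k) {x : ℝ} (hx : ∀ z : ℤ, x ≠ z)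
    (z P : ℕ → ℤ)
    (h : Tendsto (fun k => (z k : ℝ) * (p a k / q a k) - P k) atTop (𝓝 x)) :
    ∀ᶠ k in atTop, count a k (z k) = ⌊x⌋ + P k := by
  have hpar : Tendsto (fun k => (parity k : ℝ) * (1 / q a k)) atTop (𝓝 0) := by
    refine squeeze_zero_norm (fun k => ?_) (tendsto_one_div_q ha)
    rcases parity_cases k with h0 | h0 <;> simp [h0]
  have h' := h.sub hpar
  rw [sub_zero] at h'
  have hlt : (⌊x⌋ : ℝ) < x := lt_of_le_of_ne (Int.floor_le x) (hx _).symm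
  filter_upwards [h'.eventually_const_lt hlt, h'.eventually_lt_const (Int.lt_floor_add_one x)]
    with k h1 h2
  have hq : (0 : ℝ) < q a k := by exact_mod_cast q_pos ha k
  have e : (z k : ℝ) * (p a k / q a k) - P k - parity k * (1 / q a k) =
      (z k * p a k - parity k) / q a k - P k := by ring
  rw [e, lt_sub_iff_add_lt, lt_div_iff₀ hq] at h1
  rw [e, sub_lt_iff_lt_add, div_lt_iff₀ hq] at h2
  rw [count_eq_iff ha]
  constructor
  · exact_mod_cast h1.le
  · have : (z k * p a k - parity k : ℝ) < (⌊x⌋ + P k + 1) * q a k := by linarith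
    exact_mod_cast this

/-- The difference between rounding up or down a number that is not an integer, and its floor. -/
def Rounding.offset : Rounding → ℤ
  | .lower => 0
  | .upper => 1

theorem round_eq_floor_add {x : ℝ} (hx : ∀ z : ℤ, x ≠ z) (ε : Rounding) :
    ε.round x = ⌊x⌋ + ε.offset := by
  cases ε with
  | lower => simp [Rounding.round, Rounding.offset]
  | upper =>
    have hlt : (⌊x⌋ : ℝ) < x := lt_of_le_of_ne (Int.floor_le x) (hx _).symm
    have h2 := Int.lt_floor_add_one x
    simp only [Rounding.round, Rounding.offset]
    rw [Int.ceil_eq_iff]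
    push_cast
    constructor <;> linarith

theorem mul_add_ne_int (hθ : Irrational θ) {m : ℤ} (hm : m ≠ 0) (n z : ℤ) : m * θ + n ≠ z :=
  ((hθ.intCast_mul hm).add_intCast n).ne_int z

end Approximation

section Letters

variable {a β : ℕ → ℕ} {θ ρ : ℝ}

/-- Convergence of the letters if no number `n θ + ρ` with `n ≥ 0` is an integer. -/
theorem eventually_letter_of_ne_int (ha : HasRegCF θ fun n => (a (n + 1) : ℚ))
    (hβ : AdmissibleDigits a β)
    (hsum : HasSum (fun h : ℕ => (β (h + 1) : ℝ) * ((q a h : ℝ) * θ - (p a h : ℝ))) (ρ - θ))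
    (hρ : ∀ (n : ℕ) (z : ℤ), (n : ℝ) * θ + ρ ≠ z) (ε : Rounding) (n : ℕ) :
    ∀ᶠ k in atTop, periodicLetter a k (n + t a β k : ℕ) = letter ε θ ρ (n + 1) := by
  let P : ℕ → ℤ := fun k => ∑ j ∈ Finset.range k, (β (j + 1) : ℤ) * p a j
  have key : ∀ n : ℕ, ∀ᶠ k in atTop,
      count a k ((n : ℤ) + 1 + t a β k) = ⌊(n : ℝ) * θ + ρ⌋ + P k := by
    intro n
    refine eventually_count_eq ha.one_le_nat (hρ n) (fun k => (n : ℤ) + 1 + t a β k) P ?_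
    have h1 := (ha.tendsto_p_div_q).const_mul ((n : ℝ) + 1)
    have h2 := ha.tendsto_mul_sub fun k => (hβ.t_lt k).le
    have h3 := (h1.add h2).add hsum.tendsto_sum_nat
    have e : ((n : ℝ) + 1) * θ + 0 + (ρ - θ) = n * θ + ρ := by ring
    rw [e] at h3
    refine h3.congr fun k => ?_
    have e2 : ∑ j ∈ Finset.range k, (β (j + 1) : ℝ) * ((q a j : ℝ) * θ - (p a j : ℝ)) =
        t a β k * θ - P k := by
      simp only [P, t]
      push_cast
      rw [Finset.sum_mul, ← Finset.sum_sub_distrib]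
      exact Finset.sum_congr rfl fun j _ => by ring
    rw [e2]
    push_cast
    ring
  filter_upwards [key n, key (n + 1)] with k h1 h2
  rw [periodicLetter, letter, round_eq_floor_add (hρ (n + 1)), show
    (((n + 1 : ℕ) : ℝ) - 1) * θ + ρ = (n : ℝ) * θ + ρ by push_cast; ring, round_eq_floor_add (hρ n)]
  rw [show ((n + t a β k : ℕ) : ℤ) + 2 = ((n + 1 : ℕ) : ℤ) + 1 + t a β k by push_cast; ring,
    show ((n + t a β k : ℕ) : ℤ) + 1 = (n : ℤ) + 1 + t a β k by push_cast; ring, h1, h2]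
  ring

/-- The counting functions along one parity converge to the floor, respectively ceiling, of the
multiples of the slope. -/
theorem eventually_count_eq_round (ha : HasRegCF θ fun n => (a (n + 1) : ℚ)) (hθ : Irrational θ)
    (ε : Rounding) (z : ℤ) :
    ∀ᶠ k in atTop, parity k = ε.offset →
      count a k z = ε.round (z * θ) - ε.offset := by
  rcases eq_or_ne z 0 with rfl | hz
  · refine Eventually.of_forall fun k hk => ?_
    have hq : (0 : ℤ) < q a k := by exact_mod_cast q_pos ha.one_le_nat k
    rw [count_eq_iff ha.one_le_nat, hk]
    cases ε with
    | lower => simpa [Rounding.round, Rounding.offset] using hq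
    | upper => simp [Rounding.round, Rounding.offset]; omega
  · have hx : ∀ w : ℤ, (z : ℝ) * θ ≠ w := fun w => (hθ.intCast_mul hz).ne_int w
    have h1 := (ha.tendsto_p_div_q).const_mul (z : ℝ)
    filter_upwards [eventually_count_eq ha.one_le_nat hx (fun _ => z) (fun _ => 0)
      (by simpa using h1)] with k hk _
    rw [hk, round_eq_floor_add hx]
    ring

/-- Convergence of the letters if `t k = q k - m` for all `k ≥ c` congruent to `c` modulo `2`. -/
theorem eventually_letter_of_special (ha : HasRegCF θ fun n => (a (n + 1) : ℚ))
    (hθ : Irrational θ) {ε : Rounding} {c m : ℕ} {N : ℤ} (hρ : ρ - θ = -(m : ℝ) * θ + N)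
    (hc : parity c = ε.offset)
    (ht : ∀ j, t a β (c + 2 * j) + m = q a (c + 2 * j)) (n : ℕ) :
    ∀ᶠ k in atTop, k ∈ Set.range (fun j => c + 2 * j) →
      periodicLetter a k (n + t a β k : ℕ) = letter ε θ ρ (n + 1) := by
  filter_upwards [eventually_count_eq_round ha hθ ε (n + 1 - m),
    eventually_count_eq_round ha hθ ε (n + 2 - m)] with k h1 h2
  rintro ⟨j, rfl⟩
  have hpar : parity (c + 2 * j) = parity c := by unfold parity; omega
  have htj := ht j
  have e1 : ((n + t a β (c + 2 * j) : ℕ) : ℤ) + 1 = (n + 1 - m) + q a (c + 2 * j) := by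
    push_cast [← htj]; ring
  have e2 : ((n + t a β (c + 2 * j) : ℕ) : ℤ) + 2 = (n + 2 - m) + q a (c + 2 * j) := by
    push_cast [← htj]; ring
  have hround : ∀ x : ℝ, ε.round (x + N) = ε.round x + N := by
    intro x
    cases ε <;> simp [Rounding.round]
  rw [periodicLetter]
  simp only at *
  rw [e1, e2, count_add_q ha.one_le_nat, count_add_q ha.one_le_nat, h1 (hpar.trans hc),
    h2 (hpar.trans hc), letter]
  have e3 : ((n + 1 : ℕ) : ℝ) * θ + ρ = (((n : ℤ) + 2 - (m : ℤ) : ℤ) : ℝ) * θ + N := by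
    push_cast; linear_combination hρ
  have e4 : (((n + 1 : ℕ) : ℝ) - 1) * θ + ρ = (((n : ℤ) + 1 - (m : ℤ) : ℤ) : ℝ) * θ + N := by
    push_cast; linear_combination hρ
  rw [e3, e4, hround, hround]
  ring

end Letters

/-! ### The digits of the intercept -/

section Digits

variable {a β : ℕ → ℕ} {θ ρ : ℝ}

theorem IsOstrowskiExpansion.admissible (ha : ∀ k, 1 ≤ k → 1 ≤ a k) {σ : ℝ}
    (h : IsOstrowskiExpansion a θ σ β) : AdmissibleDigits a β :=
  ⟨ha, h.first, h.le, h.rule⟩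

theorem t_add_two_mul {c m : ℕ} (h0 : t a β c + m = q a c)
    (hz : ∀ j, β (c + 2 * j + 1) = 0) (he : ∀ j, β (c + 2 * j + 2) = a (c + 2 * j + 2)) (j : ℕ) :
    t a β (c + 2 * j) + m = q a (c + 2 * j) := by
  induction j with
  | zero => exact h0
  | succ j ih =>
    rw [show c + 2 * (j + 1) = c + 2 * j + 1 + 1 by ring, t_succ, t_succ, hz, he, q_add_two]
    omega

theorem t_congr {β γ : ℕ → ℕ} {n : ℕ} (h : ∀ k, 1 ≤ k → k ≤ n → β k = γ k) : t a β n = t a γ n :=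
  Finset.sum_congr rfl fun j hj => by
    rw [h (j + 1) (by omega) (by have := Finset.mem_range.1 hj; omega)]

theorem AdmissibleDigits.congr {β γ : ℕ → ℕ} (h : AdmissibleDigits a γ)
    (hβ : ∀ k, 1 ≤ k → β k = γ k) : AdmissibleDigits a β where
  one_le := h.one_le
  first := by rw [hβ 1 le_rfl]; exact h.first
  le k hk := by rw [hβ k hk]; exact h.le k hk
  rule k hk := by rw [hβ k hk, hβ (k + 1) (by omega)]; exact h.rule k hk

theorem tailA_admissible (ha : ∀ k, 1 ≤ k → 1 ≤ a k) {l N : ℕ} {δ : ℕ → ℕ}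
    (hδ : IsIntOstrowski a l N δ) : AdmissibleDigits a (tailA a δ l) where
  one_le := ha
  first := by simpa [tailA] using hδ.first
  le k hk := by
    unfold tailA
    split_ifs with h1 h2
    · exact hδ.le k hk h1
    · exact le_rfl
    · exact Nat.zero_le _
  rule k hk hkk := by
    have hak := ha (k + 1) (by omega)
    unfold tailA at *
    by_cases h1 : k + 1 ≤ l + 1
    · rw [if_pos h1] at hkk
      rw [if_pos (by omega)]
      exact hδ.rule k hk (by omega) hkk
    · rw [if_neg h1] at hkk
      by_cases h2 : Odd (k + 1 - l)
      · have h3 : ¬ k ≤ l + 1 := by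
          intro h3
          have : k = l + 1 ∨ k = l := by omega
          rcases this with rfl | rfl
          · rw [show l + 1 + 1 - l = 2 by omega] at h2
            exact absurd h2 (by decide)
          · omega
        rw [if_neg h3, if_neg]
        rw [show k + 1 - l = k - l + 1 by omega] at h2
        intro h5
        exact absurd h2 (by simpa using Odd.add_one h5)
      · rw [if_neg h2] at hkk
        omega

theorem tailB_admissible (ha : ∀ k, 1 ≤ k → 1 ≤ a k) {l m : ℕ} {δ : ℕ → ℕ}
    (hlm : q a l < m) (hml : m ≤ q a (l + 1))
    (hδ : IsIntOstrowski a l (q a (l + 1) - m) δ) : AdmissibleDigits a (tailB a δ l) := by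
  have hsum : t a δ l + δ (l + 1) * q a l + m = q a (l + 1) := by
    have := hδ.sum
    rw [Finset.sum_range_succ] at this
    change _ = t a δ l + _ at this
    omega
  have hqp : qPrev a l ≤ q a l := by
    cases l with
    | zero => simp [qPrev]
    | succ l => exact q_le_succ ha l
  rw [q_succ] at hsum
  have hle : δ (l + 1) + 1 ≤ a (l + 1) := by
    by_contra! hlt
    have : a (l + 1) * q a l ≤ δ (l + 1) * q a l := Nat.mul_le_mul_right _ (by omega)
    omega
  -- if the raised digit is maximal, then the sum of the earlier ones is too small for `δ l ≠ 0`
  have heq : δ (l + 1) + 1 = a (l + 1) → t a δ l < qPrev a l := by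
    intro heq
    rw [← heq, add_mul] at hsum
    omega
  refine ⟨ha, ?_, fun k hk => ?_, fun k hk hkk => ?_⟩
  · rcases Nat.eq_zero_or_pos l with rfl | hl
    · simp only [tailB]
      refine lt_of_le_of_ne hle fun h => ?_
      have := heq h
      simp [qPrev] at this
    · simpa [tailB, show 1 ≤ l from hl] using hδ.first
  · unfold tailB
    split_ifs with h1 h2 h3 h4
    · exact hδ.le k hk (by omega)
    · rw [h2]; exact hle
    · omega
    · exact le_rfl
    · exact Nat.zero_le _
  · have hak := ha (k + 1) (by omega)
    unfold tailB at hkk ⊢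
    rcases lt_trichotomy k l with hkl | rfl | hkl
    · rw [if_pos (by omega)] at hkk
      rw [if_pos (by omega)]
      exact hδ.rule k hk (by omega) hkk
    · rw [if_neg (by omega), if_pos rfl] at hkk
      rw [if_pos le_rfl]
      have h1 := heq hkk
      obtain ⟨k, rfl⟩ := Nat.exists_eq_add_of_le' hk
      rw [t_succ, qPrev] at h1
      by_contra h0
      have : 1 * q a k ≤ δ (k + 1) * q a k := Nat.mul_le_mul_right _ (by omega)
      omega
    · rw [if_neg (by omega), if_neg (by omega)] at hkk
      by_cases h2 : k + 1 = l + 2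
      · rw [if_pos h2] at hkk
        omega
      · rw [if_neg h2] at hkk
        by_cases h3 : Even (k + 1 - l)
        · by_cases h4 : k = l + 2
          · rw [h4, show l + 2 + 1 - l = 3 by omega] at h3
            exact absurd h3 (by decide)
          · rw [if_neg (by omega), if_neg (by omega), if_neg h4, if_neg]
            rw [show k + 1 - l = k - l + 1 by omega] at h3
            intro h5
            exact absurd h3 (by simpa using Even.add_one h5)
        · rw [if_neg h3] at hkk
          omega

theorem zeroDigits_admissible (ha : ∀ k, 1 ≤ k → 1 ≤ a k) (ε : Rounding) :
    AdmissibleDigits a (zeroDigits a ε) := by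
  have h1 := ha 1 le_rfl
  refine ⟨ha, ?_, fun k _ => ?_, fun k hk hkk => ?_⟩
  · cases ε <;> simp [zeroDigits] <;> omega
  · cases ε with
    | lower => simp only [zeroDigits]; split_ifs <;> omega
    | upper =>
      simp only [zeroDigits]
      split_ifs with h2 h3
      · rw [h2]; omega
      · exact le_rfl
      · omega
  · have hak := ha (k + 1) (by omega)
    cases ε with
    | lower =>
      simp only [zeroDigits] at *
      by_cases h2 : Even (k + 1)
      · rw [if_neg]
        intro h3
        exact absurd h2 (by simpa using Even.add_one h3)
      · rw [if_neg h2] at hkk; omega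
    | upper =>
      simp only [zeroDigits] at *
      rw [if_neg (by omega)] at hkk
      by_cases h2 : Odd (k + 1)
      · rw [if_neg, if_neg]
        · intro h3
          exact absurd h2 (by simpa using Odd.add_one h3)
        · rintro rfl
          exact absurd h2 (by decide)
      · rw [if_neg h2] at hkk; omega

/-- The data needed for the convergence: infinitely many indices along which the letters of the
periodic words converge to those of the Sturmian word. -/
theorem IsInterceptDigits.spec (ha : HasRegCF θ fun n => (a (n + 1) : ℚ)) (hθ : Irrational θ)
    {ε : Rounding} (h : IsInterceptDigits ε a θ ρ β) :
    AdmissibleDigits a β ∧ ∃ S : Set ℕ, S.Infinite ∧ (∀ k ∈ S, β (k + 1) < a (k + 1)) ∧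
      ∀ n : ℕ, ∀ᶠ k in atTop, k ∈ S →
        periodicLetter a k (n + t a β k : ℕ) = letter ε θ ρ (n + 1) := by
  have hinf : ∀ c : ℕ, (Set.range fun j : ℕ => c + 2 * j).Infinite := fun c =>
    Set.infinite_range_of_injective fun i j hij => by simpa using hij
  -- the common form of the exceptional cases
  have special : AdmissibleDigits a β → ∀ (c m : ℕ) (N : ℤ), ρ - θ = -(m : ℝ) * θ + N →
      parity c = ε.offset → t a β c + m = q a c →
      (∀ j, β (c + 2 * j + 1) = 0) → (∀ j, β (c + 2 * j + 2) = a (c + 2 * j + 2)) →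
      AdmissibleDigits a β ∧ ∃ S : Set ℕ, S.Infinite ∧ (∀ k ∈ S, β (k + 1) < a (k + 1)) ∧
        ∀ n : ℕ, ∀ᶠ k in atTop, k ∈ S →
          periodicLetter a k (n + t a β k : ℕ) = letter ε θ ρ (n + 1) := by
    intro hadm c m N hρ hc h0 hz he
    refine ⟨hadm, _, hinf c, ?_, eventually_letter_of_special ha hθ hρ hc (t_add_two_mul h0 hz he)⟩
    rintro k ⟨j, rfl⟩
    have := ha.one_le_nat (c + 2 * j + 1) (by omega)
    simp only
    rw [hz]
    omega
  rcases h with ⟨hρ, hO⟩ | ⟨m, N, l, δ, hm, hρ, hlm, hml, hδ, hβ⟩ | ⟨hρ, hβ⟩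
  · have hadm := hO.admissible ha.one_le_nat
    refine ⟨hadm, {k | β (k + 1) < a (k + 1)}, ?_, fun k hk => hk, fun n => ?_⟩
    · refine Set.infinite_of_forall_exists_gt fun N => ?_
      obtain ⟨k, hk, hNk⟩ := hO.odd_lt.exists_gt (N + 1)
      refine ⟨k - 1, ?_, by omega⟩
      rw [Set.mem_ofPred_eq, Nat.sub_add_cancel (by omega)]
      exact hk.2
    · have hne : ∀ (n : ℕ) (z : ℤ), (n : ℝ) * θ + ρ ≠ z := by
        intro n z hz
        rcases hρ with hρ | ⟨m, N, hm, hρ⟩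
        · exact hρ ⟨-n, z, by push_cast; linarith⟩
        · refine mul_add_ne_int hθ (m := n + m) (by omega) N z ?_
          rw [← hz, hρ]; push_cast; ring
      filter_upwards [eventually_letter_of_ne_int ha hadm hO.hasSum hne ε n] with k hk _
      exact hk
  · have hsum : t a δ (l + 1) + m = q a (l + 1) := by
      have : q a (l + 1) - m = t a δ (l + 1) := hδ.sum
      omega
    have caseA : (∀ k, 1 ≤ k → β k = tailA a δ l k) →
        parity (l + 1) = ε.offset → _ := fun hA hc =>
      special ((tailA_admissible ha.one_le_nat hδ).congr hA) (l + 1) m N hρ hc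
        (by rw [t_congr (γ := δ) fun k h1 h2 => by rw [hA k h1, tailA, if_pos h2]]; exact hsum)
        (fun j => by
          rw [hA _ (by omega), tailA, if_neg (by omega), if_neg]
          rw [show l + 1 + 2 * j + 1 - l = 2 * (j + 1) by omega]
          simp)
        (fun j => by
          rw [hA _ (by omega), tailA, if_neg (by omega), if_pos]
          rw [show l + 1 + 2 * j + 2 - l = 2 * (j + 1) + 1 by omega]
          exact odd_two_mul_add_one _)
    have caseB : (∀ k, 1 ≤ k → β k = tailB a δ l k) →
        parity (l + 2) = ε.offset → _ := fun hB hc =>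
      special ((tailB_admissible ha.one_le_nat hlm hml hδ).congr hB) (l + 2) m N hρ hc
        (by
          obtain ⟨A, hA⟩ := Nat.exists_eq_add_of_le' (ha.one_le_nat (l + 2) (by omega))
          have e1 : β (l + 1) = δ (l + 1) + 1 := by rw [hB _ (by omega)]; simp [tailB]
          have e2 : β (l + 1 + 1) = A := by rw [hB _ (by omega)]; simp [tailB, hA]
          rw [t_succ] at hsum
          rw [t_succ, t_succ, t_congr (γ := δ) fun k h1 h2 => by rw [hB k h1, tailB, if_pos h2],
            e1, e2, q_add_two, hA]
          linarith)
        (fun j => by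
          rw [hB _ (by omega), tailB, if_neg (by omega), if_neg (by omega), if_neg (by omega),
            if_neg]
          rw [show l + 2 + 2 * j + 1 - l = 2 * (j + 1) + 1 by omega]
          simp)
        (fun j => by
          rw [hB _ (by omega), tailB, if_neg (by omega), if_neg (by omega), if_neg (by omega),
            if_pos]
          rw [show l + 2 + 2 * j + 2 - l = 2 * (j + 2) by omega]
          simp)
    cases ε with
    | lower =>
      by_cases hl : Odd l
      · refine caseA (fun k hk => by rw [hβ k hk, specialDigits, if_pos hl]) ?_
        rw [Nat.odd_iff] at hl
        simp [parity, Rounding.offset]; omega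
      · refine caseB (fun k hk => by rw [hβ k hk, specialDigits, if_neg hl]) ?_
        rw [Nat.odd_iff] at hl
        simp [parity, Rounding.offset]; omega
    | upper =>
      by_cases hl : Odd l
      · refine caseB (fun k hk => by rw [hβ k hk, specialDigits, if_pos hl]) ?_
        rw [Nat.odd_iff] at hl
        simp [parity, Rounding.offset]; omega
      · refine caseA (fun k hk => by rw [hβ k hk, specialDigits, if_neg hl]) ?_
        rw [Nat.odd_iff] at hl
        simp [parity, Rounding.offset]; omega
  · have hadm := (zeroDigits_admissible ha.one_le_nat ε).congr hβ
    have hρ' : ρ - θ = -((1 : ℕ) : ℝ) * θ + (0 : ℤ) := by rw [hρ]; push_cast; ring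
    cases ε with
    | lower =>
      refine special hadm 0 1 0 hρ' (by simp [parity, Rounding.offset]) (by simp [t_zero, q])
        (fun j => ?_)
        (fun j => ?_)
      · rw [hβ _ (by omega), zeroDigits, if_neg]
        rw [zero_add]; simp
      · rw [hβ _ (by omega), zeroDigits, if_pos]
        rw [show 0 + 2 * j + 2 = 2 * (j + 1) by ring]; simp
    | upper =>
      have h1 := ha.one_le_nat 1 le_rfl
      refine special hadm 1 1 0 hρ' (by simp [parity, Rounding.offset]) ?_ (fun j => ?_)
        (fun j => ?_)
      · rw [t_succ, t_zero, hβ 1 le_rfl]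
        simp [zeroDigits, q]
        omega
      · rw [hβ _ (by omega), zeroDigits, if_neg (by omega), if_neg]
        rw [show 1 + 2 * j + 1 = 2 * (j + 1) by ring]; simp
      · rw [hβ _ (by omega), zeroDigits, if_neg (by omega), if_pos]
        rw [show 1 + 2 * j + 2 = 2 * (j + 1) + 1 by ring]
        exact odd_two_mul_add_one _

end Digits

/-! ### The generic expansion and the characteristic word -/

section Expansions

variable {b : ℕ} {a β : ℕ → ℕ}

theorem AdmissibleDigits.merged_eq_improper (h : AdmissibleDigits a β) (hb : 2 ≤ b)
    (hβ : ∀ k, β (k + 2) ≠ a (k + 2)) : merged b a β = improper b a β := by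
  have hm : ∀ i, ¬ MergeAt b a β i := by
    rintro i ⟨-, hi⟩
    exact hβ _ ((h.cSeq_neg_iff hb).1 hi)
  have hpos : ∀ n, mergePos b a β n = n := by
    intro n
    induction n with
    | zero => rfl
    | succ n ih => rw [mergePos_succ_of_not (hm _), ih]
  funext n
  rw [merged_of_not (hm _), hpos]

theorem cSeq_pos (hb : 2 ≤ b) (ha : ∀ k, 1 ≤ k → 1 ≤ a k) {k : ℕ}
    (hk : β (k + 1) + 2 ≤ a (k + 1)) : 0 < cSeq b a β k := by
  have hb1 : (1 : ℚ) < b := by exact_mod_cast hb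
  have h1 := one_lt_pow_q hb ha k
  have hq : (0 : ℤ) < q a k := by exact_mod_cast q_pos ha k
  have h2 : (1 : ℚ) < (b : ℚ) ^ (((a (k + 1) : ℤ) - (β (k + 1) : ℤ) - 1) * (q a k : ℤ)) :=
    one_lt_zpow₀ hb1 (mul_pos (by omega) hq)
  rw [cSeq]
  exact mul_pos (zpow_pos (by linarith) _) (div_pos (by linarith) (by linarith))

theorem isContraction_generic (h : AdmissibleDigits a β) (hb : 2 ≤ b)
    (hβ : ∀ k, β (k + 2) ≠ a (k + 2)) :
    IsContraction (merged b a β) (genericExpansion b a β) := by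
  rw [h.merged_eq_improper hb hβ]
  refine ⟨fun n => Nat.casesOn n 0 (· + 3), rfl, strictMono_nat_of_lt_succ ?_, ?_⟩
  · rintro (_ | n) <;> simp
  · rintro (_ | n)
    · change Relation.ReflTransGen ZeroStep
        [improper b a β (5 * 0), improper b a β (5 * 0 + 1), improper b a β (5 * 0 + 2)]
        [cSeq b a β 0 + 1]
      rw [improper_five_mul, improper_five_mul_add_one, improper_five_mul_add_two,
        dSeq_eq_zero (t_zero a β)]
      exact zeroStep_three _ _
    · simp only [show n + 1 + 3 - (n + 3) = 1 by omega]
      exact Relation.ReflTransGen.refl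

theorem genericExpansion_pos (h : AdmissibleDigits a β) (hb : 2 ≤ b)
    (hβ : ∀ k, 1 ≤ k → β k + 2 ≤ a k ∧ 1 ≤ β k) (n : ℕ) : 0 < genericExpansion b a β n := by
  have hc : ∀ k, 0 < cSeq b a β k := fun k => cSeq_pos hb h.one_le (hβ (k + 1) (by omega)).1
  rcases n with _ | n
  · exact add_pos (hc 0) one_pos
  · change 0 < improper b a β (n + 3)
    obtain ⟨k, s, hs, hn⟩ : ∃ k s, s < 5 ∧ n + 3 = 5 * k + s :=
      ⟨(n + 3) / 5, (n + 3) % 5, by omega, by omega⟩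
    rw [hn]
    obtain rfl | rfl | rfl | rfl | rfl : s = 0 ∨ s = 1 ∨ s = 2 ∨ s = 3 ∨ s = 4 := by omega
    · rw [add_zero, improper_five_mul]; exact hc k
    · rw [improper_five_mul_add_one]
      refine dSeq_pos hb ?_
      obtain ⟨k, rfl⟩ := Nat.exists_eq_add_of_le' (show 1 ≤ k by omega)
      rw [t_succ]
      have := Nat.mul_pos (hβ (k + 1) (by omega)).2 (q_pos h.one_le k)
      omega
    · rw [improper_five_mul_add_two]; exact one_pos
    · rw [improper_five_mul_add_three]; exact h.eSeq_pos hb k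
    · rw [improper_five_mul_add_four]; exact fSeq_pos hb h.one_le (hβ (k + 1) (by omega)).2

theorem zeroSeq_admissible (ha : ∀ k, 1 ≤ k → 1 ≤ a k) : AdmissibleDigits a fun _ => 0 :=
  ⟨ha, ha 1 le_rfl, fun _ _ => Nat.zero_le _, fun _ _ _ => rfl⟩

theorem t_zeroSeq (k : ℕ) : t a (fun _ => 0) k = 0 := by simp [t]

theorem r_zeroSeq (k : ℕ) : r a (fun _ => 0) k = q a k := by simp [r, t_zeroSeq]

theorem bohmerQuotient_zero (hb : 2 ≤ b) (ha : ∀ k, 1 ≤ k → 1 ≤ a k) :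
    cSeq b a (fun _ => 0) 0 + 1 = bohmerQuotient b a 0 := by
  have hc := cSeq_mul (β := fun _ => 0) hb ha 0
  rw [bohmerQuotient, eq_div_iff (pow_q_ne_one hb ha 0), add_mul, hc, r_zeroSeq, r_zeroSeq]
  simp [q, qPrev]

theorem bohmerQuotient_succ (hb : 2 ≤ b) (ha : ∀ k, 1 ≤ k → 1 ≤ a k) (n : ℕ) :
    eSeq b a (fun _ => 0) n + cSeq b a (fun _ => 0) (n + 1) + 1 = bohmerQuotient b a (n + 1) := by
  have hb0 : (b : ℚ) ≠ 0 := by positivity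
  have hc := cSeq_mul (β := fun _ => 0) hb ha (n + 1)
  rw [r_zeroSeq, r_zeroSeq, zpow_add₀ hb0, zpow_natCast, zpow_natCast, zpow_natCast] at hc
  rw [bohmerQuotient, eq_div_iff (pow_q_ne_one hb ha (n + 1)), eSeq, r_zeroSeq, zpow_natCast]
  rw [qPrev] at hc ⊢
  linear_combination hc

theorem bohmerQuotient_pos (hb : 2 ≤ b) (ha : ∀ k, 1 ≤ k → 1 ≤ a k) (n : ℕ) :
    0 < bohmerQuotient b a n := by
  have h1 := one_lt_pow_q hb ha n
  have h2 : qPrev a n < q a (n + 1) := by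
    have := Nat.mul_pos (ha (n + 1) (by omega)) (q_pos ha n)
    rw [q_succ]
    omega
  have h3 : (b : ℚ) ^ qPrev a n < (b : ℚ) ^ q a (n + 1) :=
    pow_lt_pow_right₀ (by exact_mod_cast hb) h2
  exact div_pos (by linarith) (by linarith)

theorem isContraction_bohmer (hb : 2 ≤ b) (ha : ∀ k, 1 ≤ k → 1 ≤ a k) :
    IsContraction (merged b a fun _ => 0) (bohmerQuotient b a) := by
  have h := zeroSeq_admissible ha
  rw [h.merged_eq_improper hb fun k => by have := ha (k + 2) (by omega); omega]
  have hd : ∀ k, dSeq b a (fun _ => 0) k = 0 := fun k => dSeq_eq_zero (t_zeroSeq k)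
  have hf : ∀ k, fSeq b a (fun _ => 0) k = 0 := fun k => fSeq_eq_zero rfl
  refine ⟨fun n => Nat.casesOn n 0 (fun n => 5 * n + 3), rfl, strictMono_nat_of_lt_succ ?_, ?_⟩
  · rintro (_ | n)
    · simp
    · simp
  · rintro (_ | n)
    · change Relation.ReflTransGen ZeroStep
        [improper b a (fun _ => 0) (5 * 0), improper b a (fun _ => 0) (5 * 0 + 1),
          improper b a (fun _ => 0) (5 * 0 + 2)] [bohmerQuotient b a 0]
      rw [improper_five_mul, improper_five_mul_add_one, improper_five_mul_add_two, hd,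
        ← bohmerQuotient_zero hb ha]
      exact zeroStep_three _ _
    · simp only [show 5 * (n + 1) + 3 - (5 * n + 3) = 5 by omega]
      change Relation.ReflTransGen ZeroStep
        [improper b a (fun _ => 0) (5 * n + 3), improper b a (fun _ => 0) (5 * n + 4),
          improper b a (fun _ => 0) (5 * (n + 1)), improper b a (fun _ => 0) (5 * (n + 1) + 1),
          improper b a (fun _ => 0) (5 * (n + 1) + 2)] [bohmerQuotient b a (n + 1)]
      rw [improper_five_mul, improper_five_mul_add_one, improper_five_mul_add_two, hd,
        improper_five_mul_add_three, improper_five_mul_add_four, hf,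
        ← bohmerQuotient_succ hb ha]
      exact zeroStep_five _ _ _

end Expansions

section Characteristic

variable {a : ℕ → ℕ} {θ : ℝ}

/-- The characteristic word of slope `θ` has all its digits equal to `0`. -/
theorem isInterceptDigits_zeroSeq (ha : ∀ k, 1 ≤ k → 1 ≤ a k) (ε : Rounding) :
    IsInterceptDigits ε a θ θ fun _ => 0 := by
  refine Or.inl ⟨Or.inr ⟨1, 0, le_rfl, by simp⟩, ?_⟩
  have h := zeroSeq_admissible ha
  refine ⟨h.first, h.le, h.rule, by simp, ?_, ?_⟩
  · exact Set.infinite_of_forall_exists_gt fun N =>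
      ⟨2 * N + 1, ⟨odd_two_mul_add_one N, ha _ (by omega)⟩, by omega⟩
  · exact Set.infinite_of_forall_exists_gt fun N =>
      ⟨2 * (N + 1), ⟨by omega, even_two_mul _, ha _ (by omega)⟩, by omega⟩

/-- The letters `1` of the characteristic word are at the positions `⌊j / θ⌋`, `j ≥ 1`. -/
theorem sturmianNumber_characteristic (b : ℕ) (hθ : Irrational θ) (hθ0 : 0 < θ) (hθ1 : θ < 1)
    (ε : Rounding) :
    sturmianNumber b ε θ θ =
      ((b : ℝ) - 1) * ∑' j : ℕ, 1 / (b : ℝ) ^ ⌊((j : ℝ) + 1) / θ⌋₊ := by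
  have hne : ∀ (n : ℕ) (z : ℤ), ((n : ℝ) + 1) * θ ≠ z := by
    intro n z
    have := (hθ.natCast_mul (Nat.succ_ne_zero n)).ne_int z
    simpa using this
  have hletter : ∀ n : ℕ, letter ε θ θ (n + 1) =
      ⌊((n + 1 : ℕ) + 1 : ℝ) * θ⌋ - ⌊((n : ℝ) + 1) * θ⌋ := by
    intro n
    rw [letter, show ((n + 1 : ℕ) : ℝ) * θ + θ = ((n + 1 : ℕ) + 1 : ℝ) * θ by ring,
      show (((n + 1 : ℕ) : ℝ) - 1) * θ + θ = ((n : ℝ) + 1) * θ by push_cast; ring,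
      round_eq_floor_add (hne (n + 1)), round_eq_floor_add (hne n)]
    ring
  have hx : ∀ j : ℕ, 1 < ((j : ℝ) + 1) / θ := by
    intro j
    rw [lt_div_iff₀ hθ0]
    have : (0 : ℝ) ≤ j := Nat.cast_nonneg j
    linarith
  have hfl : ∀ j : ℕ, 1 ≤ ⌊((j : ℝ) + 1) / θ⌋₊ := fun j =>
    Nat.le_floor (by exact_mod_cast (hx j).le)
  let g : ℕ → ℕ := fun j => ⌊((j : ℝ) + 1) / θ⌋₊ - 1
  have hg : ∀ j, g j + 1 = ⌊((j : ℝ) + 1) / θ⌋₊ := fun j => Nat.sub_add_cancel (hfl j)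
  have hmono : StrictMono g := by
    refine strictMono_nat_of_lt_succ fun j => ?_
    have h1 : ⌊((j : ℝ) + 1) / θ⌋₊ + 1 ≤ ⌊(((j + 1 : ℕ) : ℝ) + 1) / θ⌋₊ := by
      rw [← Nat.floor_add_one (by have := hx j; linarith)]
      refine Nat.floor_le_floor ?_
      have h2 : 1 ≤ 1 / θ := (one_le_div hθ0).2 hθ1.le
      have h3 : (((j + 1 : ℕ) : ℝ) + 1) / θ = ((j : ℝ) + 1) / θ + 1 / θ := by
        push_cast; ring
      linarith
    have := hg j
    have := hg (j + 1)
    omega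
  have hval : ∀ j, letter ε θ θ (g j + 1) = 1 := by
    intro j
    rw [hletter]
    have h1 := Nat.floor_le (a := ((j : ℝ) + 1) / θ) (by have := hx j; linarith)
    have h2 := Nat.lt_floor_add_one (((j : ℝ) + 1) / θ)
    rw [← hg j] at h1 h2
    rw [le_div_iff₀ hθ0] at h1
    rw [div_lt_iff₀ hθ0] at h2
    push_cast at h1 h2
    have h3 : ((g j : ℝ) + 1) * θ ≠ j + 1 := by exact_mod_cast hne (g j) (j + 1)
    have h4 := lt_of_le_of_ne h1 h3
    have e1 : ⌊((g j : ℝ) + 1) * θ⌋ = j := by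
      rw [Int.floor_eq_iff]
      constructor <;> push_cast <;> nlinarith
    have e2 : ⌊((g j + 1 : ℕ) + 1 : ℝ) * θ⌋ = j + 1 := by
      rw [Int.floor_eq_iff]
      constructor <;> push_cast <;> nlinarith
    rw [e1, e2]
    ring
  have hsupp : (Function.support fun n : ℕ => (letter ε θ θ (n + 1) : ℝ) / (b : ℝ) ^ (n + 1)) ⊆
      Set.range g := by
    intro n hn
    have hn0 : letter ε θ θ (n + 1) ≠ 0 := by
      intro h0
      exact hn (by simp [h0])
    rw [hletter] at hn0
    have hle : ⌊((n : ℝ) + 1) * θ⌋ ≤ ⌊((n + 1 : ℕ) + 1 : ℝ) * θ⌋ := by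
      refine Int.floor_le_floor ?_
      push_cast
      nlinarith
    have h0 : 0 ≤ ⌊((n : ℝ) + 1) * θ⌋ := Int.floor_nonneg.2 (by positivity)
    set J := ⌊((n + 1 : ℕ) + 1 : ℝ) * θ⌋ with hJ
    have hlt : ⌊((n : ℝ) + 1) * θ⌋ < J := by omega
    obtain ⟨j, hj⟩ : ∃ j : ℕ, J = j + 1 := ⟨(J - 1).toNat, by omega⟩
    have h1 : ((n : ℝ) + 1) * θ < j + 1 := by
      have := Int.floor_lt.1 hlt
      rw [hj] at this
      exact_mod_cast this
    have h2 : (j : ℝ) + 1 ≤ ((n + 1 : ℕ) + 1 : ℝ) * θ := by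
      have := Int.floor_le (((n + 1 : ℕ) + 1 : ℝ) * θ)
      rw [← hJ, hj] at this
      exact_mod_cast this
    have h3 : ((n + 1 : ℕ) + 1 : ℝ) * θ ≠ j + 1 := by exact_mod_cast hne (n + 1) (j + 1)
    have h4 := lt_of_le_of_ne h2 h3.symm
    have h5 : ⌊((j : ℝ) + 1) / θ⌋₊ = n + 1 := by
      rw [Nat.floor_eq_iff (by positivity), le_div_iff₀ hθ0, div_lt_iff₀ hθ0]
      push_cast at h4 ⊢
      exact ⟨h1.le, h4⟩
    exact ⟨j, by have := hg j; omega⟩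
  rw [sturmianNumber, ← hmono.injective.tsum_eq hsupp]
  congr 1
  refine tsum_congr fun j => ?_
  rw [hval, hg, Int.cast_one]

end Characteristic

end SturmianCF

theorem theorem2p3 (b : ℕ) (hb : 2 ≤ b) (θ ρ : ℝ) (hθ : Irrational θ)
    (hθ0 : 0 ≤ θ) (hθ1 : θ < 1) (hρ0 : 0 ≤ ρ) (hρ1 : ρ < 1)
    (ε : SturmianCF.Rounding) (a β : ℕ → ℕ)
    (ha : SturmianCF.HasRegCF θ (fun n => (a (n + 1) : ℚ)))
    (hβ : SturmianCF.IsInterceptDigits ε a θ ρ β) :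
    ((∀ k, 1 ≤ k → β k + 2 ≤ a k ∧ 1 ≤ β k) →
      SturmianCF.HasRegCF (SturmianCF.sturmianNumber b ε θ ρ)
        (SturmianCF.genericExpansion b a β)) ∧
    (∃ A : ℕ → ℕ, (∀ n, 0 < A n) ∧
      SturmianCF.IsContraction (SturmianCF.merged b a β) (fun n => (A n : ℚ)) ∧
      (∀ A' : ℕ → ℚ, (∀ n, 0 < A' n) →
        SturmianCF.IsContraction (SturmianCF.merged b a β) A' → ∀ n, A' n = (A n : ℚ)) ∧
      SturmianCF.HasRegCF (SturmianCF.sturmianNumber b ε θ ρ) (fun n => (A n : ℚ)) ∧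
      (∀ n, ∃ v : ℚ,
        (GenContFract.of (SturmianCF.sturmianNumber b ε θ ρ)).convs (n + 1) = (v : ℝ) ∧
        SturmianCF.IsTypedConvergent b a β (A n : ℚ) v)) ∧
    (ρ = θ →
      SturmianCF.sturmianNumber b ε θ ρ =
        ((b : ℝ) - 1) * ∑' j : ℕ, 1 / (b : ℝ) ^ ⌊((j : ℝ) + 1) / θ⌋₊ ∧
      SturmianCF.HasRegCF (SturmianCF.sturmianNumber b ε θ ρ)
        (SturmianCF.bohmerQuotient b a)) := by
  have main : ∀ (ρ : ℝ) (β : ℕ → ℕ), SturmianCF.IsInterceptDigits ε a θ ρ β →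
      ∀ A : ℕ → ℚ, (∀ n, 0 < A n) →
      SturmianCF.IsContraction (SturmianCF.merged b a β) A →
      SturmianCF.HasRegCF (SturmianCF.sturmianNumber b ε θ ρ) A ∧ ∀ n, ∃ z : ℕ, A n = z := by
    intro ρ β hβ A hA hc
    obtain ⟨h, S, hS, hSβ, hl⟩ := hβ.spec ha hθ
    exact SturmianCF.hasRegCF_of_isContraction (h.merged_nat hb) hA hc
      (h.merged_limit_point hb hS hSβ hl)
  obtain ⟨h, -⟩ := hβ.spec ha hθ
  refine ⟨fun hgen => ?_, ?_, ?_⟩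
  · refine (main ρ β hβ _ (SturmianCF.genericExpansion_pos h hb hgen)
      (SturmianCF.isContraction_generic h hb fun k => ?_)).1
    have := (hgen (k + 2) (by omega)).1
    omega
  · obtain ⟨A, hA, hc, htype⟩ := h.exists_contraction hb
    obtain ⟨hcf, hnat⟩ := main ρ β hβ A hA hc
    choose B hB using hnat
    have hAB : A = fun n => (B n : ℚ) := funext hB
    refine ⟨B, fun n => ?_, hAB ▸ hc, fun A' hA' hc' n => ?_, hAB ▸ hcf, fun n => ?_⟩
    · have := hA n
      rw [hB] at this
      exact_mod_cast this
    · rw [← hB, (main ρ β hβ A' hA' hc').1.unique hcf]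
    · exact ⟨_, hcf.convs (n + 1), hB n ▸ htype n⟩
  · rintro rfl
    have hpos : 0 < ρ := lt_of_le_of_ne hθ0 hθ.ne_zero.symm
    exact ⟨SturmianCF.sturmianNumber_characteristic b hθ hpos hθ1 ε,
      (main ρ _ (SturmianCF.isInterceptDigits_zeroSeq ha.one_le_nat ε) _
        (SturmianCF.bohmerQuotient_pos hb ha.one_le_nat)
        (SturmianCF.isContraction_bohmer hb ha.one_le_nat)).1⟩
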